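/- Let $1<p<\infty$ and let $\varphi:(0,\infty)\to[0,\infty)$ be locally integrable on $(0,\infty)$. For suitable $f:\mathbb R\to\mathbb C$ let $$H_\varphi f(x)=\int_0^\infty f\!\left(\frac xt\right)\frac{\varphi(t)}{t}\,dt,\qquad H f(x)=\frac1\pi\,\mathrm{p.v.}\!\int_{-\infty}^{\infty}\frac{f(y)}{x-y}\,dy=\frac1\pi\lim_{\varepsilon\to0^+}\int_{|x-y|>\varepsilon}\frac{f(y)}{x-y}\,dy$$ be the Hausdorff operator and the Hilbert transform. Call $H_\varphi$ bounded on $L^p(\mathbb R)$ (complex-valued functions) if there is a finite constant $C$ such that, for every $f\in L^p(\mathbb R)$, the integral defining $H_\varphi f(x)$ converges absolutely for almost every $x$, $H_\varphi f\in L^p(\mathbb R)$, and $\|H_\varphi f\|_{L^p}\le C\|f\|_{L^p}$; the least such $C$ is the norm $\|H_\varphi\|_{L^p(\mathbb R)\to L^p(\mathbb R)}$. Then $H_\varphi$ is bounded on $L^p(\mathbb R)$ if and only if $$\int_0^\infty t^{1/p-1}\varphi(t)\,dt<\infty .$$ Moreover, in that case, $$\|H_\varphi\|_{L^p(\mathbb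 R)\to L^p(\mathbb R)}=\int_0^\infty t^{1/p-1}\varphi(t)\,dt,$$ and $H_\varphi$ commutes with the Hilbert transform on $L^p(\mathbb R)$: for every $f\in L^p(\mathbb R)$, the principal values $Hf(x)$ and $H(H_\varphi f)(x)$ exist for almost every $x$, $Hf\in L^p(\mathbb R)$, the integral defining $H_\varphi(Hf)(x)$ converges absolutely for almost every $x$, and $H_\varphi(Hf)=H(H_\varphi f)$ almost everywhere. -/

import Mathlib

open MeasureTheory Set Filter Topology
open scoped ENNReal NNReal

noncomputable section

/-- The real Hausdorff operator `H_φ f (x) = ∫_0^∞ f (x / t) φ(t) / t dt`. -/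
def hausdorffOperator (φ : ℝ → ℝ) (f : ℝ → ℂ) (x : ℝ) : ℂ :=
  ∫ t in Ioi (0 : ℝ), f (x / t) * ((φ t / t : ℝ) : ℂ)

/-- The integral that defines `H_φ f (x)` converges absolutely. -/
def HausdorffDefinedAt (φ : ℝ → ℝ) (f : ℝ → ℂ) (x : ℝ) : Prop :=
  IntegrableOn (fun t : ℝ => f (x / t) * ((φ t / t : ℝ) : ℂ)) (Ioi 0)

/-- `H_φ` is bounded on `L^p(ℝ)`: for each (complex-valued) `f ∈ L^p(ℝ)` the function `H_φ f` is
defined almost everywhere and lies in `L^p(ℝ)`, and `‖H_φ f‖_p ≤ C ‖f‖_p` with a finite `C`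
that does not depend on `f`. -/
def HausdorffBoundedOn (φ : ℝ → ℝ) (p : ℝ≥0∞) : Prop :=
  ∃ C : ℝ≥0, ∀ f : ℝ → ℂ, MemLp f p volume →
    (∀ᵐ x, HausdorffDefinedAt φ f x) ∧
    MemLp (hausdorffOperator φ f) p volume ∧
    eLpNorm (hausdorffOperator φ f) p volume ≤ C * eLpNorm f p volume

/-- The operator norm of `H_φ` on `L^p(ℝ)`: the smallest `C` with `‖H_φ f‖_p ≤ C ‖f‖_p` for all
`f ∈ L^p(ℝ)`. (Used only when `H_φ` is bounded on `L^p(ℝ)`.) -/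
def hausdorffNorm (φ : ℝ → ℝ) (p : ℝ≥0∞) : ℝ≥0∞ :=
  sInf {C : ℝ≥0∞ | ∀ f : ℝ → ℂ, MemLp f p volume →
    eLpNorm (hausdorffOperator φ f) p volume ≤ C * eLpNorm f p volume}

/-- The truncated integral `(1 / π) ∫_{|x - y| > ε} f(y) / (x - y) dy`. -/
def truncatedHilbert (ε : ℝ) (f : ℝ → ℂ) (x : ℝ) : ℂ :=
  ((1 / Real.pi : ℝ) : ℂ) * ∫ y in {y : ℝ | ε < |x - y|}, f y / ((x - y : ℝ) : ℂ)

/-- The principal value integral that defines `H f (x)` exists: the truncated integrals converge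
absolutely, and they have a limit as `ε → 0+`. -/
def HilbertDefinedAt (f : ℝ → ℂ) (x : ℝ) : Prop :=
  (∀ ε : ℝ, 0 < ε →
    IntegrableOn (fun y : ℝ => f y / ((x - y : ℝ) : ℂ)) {y : ℝ | ε < |x - y|}) ∧
  ∃ v : ℂ, Tendsto (fun ε : ℝ => truncatedHilbert ε f x) (𝓝[>] 0) (𝓝 v)

/-- The Hilbert transform `H f (x) = (1 / π) p.v. ∫ f(y) / (x - y) dy`. -/
def hilbertTransform (f : ℝ → ℂ) (x : ℝ) : ℂ :=
  limUnder (𝓝[>] (0 : ℝ)) (fun ε : ℝ => truncatedHilbert ε f x)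

/-- `H_φ` commutes with the Hilbert transform `H` on `L^p(ℝ)`: for each `f ∈ L^p(ℝ)`, the Hilbert
transforms of `f` and of `H_φ f` exist almost everywhere, `H f` lies in `L^p(ℝ)`, `H_φ (H f)` is
defined almost everywhere, and `H_φ (H f) = H (H_φ f)` almost everywhere. -/
def HausdorffCommutesWithHilbert (φ : ℝ → ℝ) (p : ℝ≥0∞) : Prop :=
  ∀ f : ℝ → ℂ, MemLp f p volume →
    (∀ᵐ x, HilbertDefinedAt f x) ∧
    MemLp (hilbertTransform f) p volume ∧
    (∀ᵐ x, HilbertDefinedAt (hausdorffOperator φ f) x) ∧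
    (∀ᵐ x, HausdorffDefinedAt φ (hilbertTransform f) x) ∧
    (∀ᵐ x, hausdorffOperator φ (hilbertTransform f) x = hilbertTransform (hausdorffOperator φ f) x)

/-- The integral `∫_0^∞ t^(1/p - 1) φ(t) dt ∈ [0, ∞]` of a nonnegative `φ`. -/
def hausdorffIntegral (φ : ℝ → ℝ) (p : ℝ) : ℝ≥0∞ :=
  ∫⁻ t in Ioi (0 : ℝ), ENNReal.ofReal (t ^ (1 / p - 1) * φ t)

end

/-! Write K for the integral of t^(1/p-1) φ(t). The Hausdorff operator is a superposition of the
dilations f(·/t), and dilation by t multiplies the L^p norm by t^(1/p). A Minkowski-type inequality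
therefore bounds its norm by K (`lintegral_hausdorffMajorant_rpow_le`). Conversely, x^(-1/p) is
formally an eigenfunction with eigenvalue K that just fails to lie in L^p. Truncated to [1, e^L], it
loses only a fraction of order 1/L to edge effects, so every admissible constant is at least K
(`hausdorffIntegral_le_of_bound`). This gives both the necessity of K < ∞ and the value of the norm.

Commutation is plausible because the Hilbert transform commutes with dilations, but a principal
value does not pass directly under the integral in t. The relation "g is the Hilbert transform of f"
is replaced by Q_y * f = P_y * g for all y > 0, where P_y and Q_y are the Poisson and conjugate
Poisson kernels. These convolutions converge absolutely, so Fubini applies, and dilation by t only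
changes the height y to y/t. Hence the relation passes from (f, g) to (H_φ f, H_φ g)
(`kernelConv_hausdorffOperator_conj`).

Two classical facts translate back. A conjugate function g exists in L^p (`exists_memLp_conjugate`).
This rests on M. Riesz's theorem: for f ≥ 0 and 1 < p ≤ 2, the function F = P_y * f + i Q_y * f is
holomorphic with values in the right half-plane, F^p integrates to zero along horizontal lines, and
|w|^p ≤ A (Re w)^p - B Re(w^p) then controls |F| by Re F; duality covers p > 2
(`exists_conjPoissonBoundedBy`). Finally, the truncated integrals converge to g almost everywhere
(`ae_tendsto_truncatedHilbert`), because the kernel truncated at ε differs from Q_ε by an odd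
function dominated by P_ε. -/

/-! ### Poisson and conjugate Poisson kernels -/

/-- The Poisson kernel of the upper half-plane, at height `y`. -/
noncomputable def poissonLine (y u : ℝ) : ℝ := Real.pi⁻¹ * (y / (u ^ 2 + y ^ 2))

/-- The conjugate Poisson kernel of the upper half-plane, at height `y`. -/
noncomputable def conjPoissonLine (y u : ℝ) : ℝ := Real.pi⁻¹ * (u / (u ^ 2 + y ^ 2))

/-- Convolution of a complex-valued function with a real kernel. -/
noncomputable def kernelConv (k : ℝ → ℝ) (f : ℝ → ℂ) (x : ℝ) : ℂ :=
  ∫ t, (k (x - t) : ℂ) * f t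

lemma poissonLine_nonneg {y : ℝ} (hy : 0 < y) (u : ℝ) : 0 ≤ poissonLine y u := by
  unfold poissonLine; positivity

lemma measurable_poissonLine (y : ℝ) : Measurable (poissonLine y) := by
  unfold poissonLine; fun_prop

lemma measurable_conjPoissonLine (y : ℝ) : Measurable (conjPoissonLine y) := by
  unfold conjPoissonLine; fun_prop

lemma conjPoissonLine_neg (y u : ℝ) : conjPoissonLine y (-u) = -conjPoissonLine y u := by
  simp [conjPoissonLine, neg_div]

lemma integral_poissonLine {y : ℝ} (hy : 0 < y) : ∫ u, poissonLine y u = 1 := by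
  have h : ∀ u, poissonLine y u = Real.pi⁻¹ * (y⁻¹ * (1 + (u / y) ^ 2)⁻¹) := fun u => by
    unfold poissonLine; field_simp; ring
  simp_rw [h, integral_const_mul]
  rw [Measure.integral_comp_div (fun u : ℝ => (1 + u ^ 2)⁻¹) y, integral_univ_inv_one_add_sq,
    abs_of_pos hy, smul_eq_mul]
  field_simp

lemma integrable_poissonLine {y : ℝ} (hy : 0 < y) : Integrable (poissonLine y) :=
  Integrable.of_integral_ne_zero (by rw [integral_poissonLine hy]; exact one_ne_zero)

lemma lintegral_poissonLine {y : ℝ} (hy : 0 < y) :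
    ∫⁻ u, ENNReal.ofReal (poissonLine y u) = 1 := by
  rw [← ofReal_integral_eq_lintegral_ofReal (integrable_poissonLine hy)
    (Eventually.of_forall (poissonLine_nonneg hy)), integral_poissonLine hy, ENNReal.ofReal_one]

/-- A kernel of size `O(1 / (1 + |u|))` lies in every `L^q`, `q > 1`. -/
lemma memLp_of_le_inv_one_add_abs {k : ℝ → ℝ} (hk : Measurable k) {c : ℝ}
    (hc : ∀ u, |k u| ≤ c * (1 + |u|)⁻¹) {q : ℝ} (hq : 1 < q) :
    MemLp k (ENNReal.ofReal q) := by
  have h : MemLp (fun u : ℝ => (1 + ‖u‖)⁻¹) (ENNReal.ofReal q) := by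
    rw [← integrable_norm_rpow_iff (by fun_prop) (by simpa using by linarith) ENNReal.ofReal_ne_top]
    have := integrable_one_add_norm (E := ℝ) (μ := volume) (r := q) (by simpa using hq)
    refine this.congr (Eventually.of_forall fun u => ?_)
    have h1 : (0 : ℝ) ≤ 1 + ‖u‖ := by positivity
    simp only
    rw [ENNReal.toReal_ofReal (by linarith), Real.norm_of_nonneg (inv_nonneg.2 h1),
      Real.inv_rpow h1, Real.rpow_neg h1]
  refine (h.const_mul c).of_le hk.aestronglyMeasurable (Eventually.of_forall fun u => ?_)
  calc ‖k u‖ ≤ c * (1 + |u|)⁻¹ := hc u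
    _ ≤ _ := le_abs_self _

lemma abs_poissonLine_le {y : ℝ} (hy : 0 < y) (u : ℝ) :
    |poissonLine y u| ≤ (1 + y⁻¹) * (1 + |u|)⁻¹ := by
  rw [abs_of_nonneg (poissonLine_nonneg hy u)]
  have hpi : Real.pi⁻¹ ≤ 1 := inv_le_one_of_one_le₀ (by linarith [Real.pi_gt_three])
  have h1 : y / (u ^ 2 + y ^ 2) ≤ (1 + y⁻¹) * (1 + |u|)⁻¹ := by
    rw [← div_eq_mul_inv, div_le_div_iff₀ (by positivity) (by positivity)]
    have h2 : (1 + y⁻¹) * (u ^ 2 + y ^ 2) = u ^ 2 + y ^ 2 + y⁻¹ * u ^ 2 + y := by field_simp; ring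
    rw [h2]
    have h3 : 0 ≤ y⁻¹ * u ^ 2 := by positivity
    nlinarith [sq_nonneg (|u| - y), sq_abs u, abs_nonneg u]
  calc poissonLine y u ≤ 1 * (y / (u ^ 2 + y ^ 2)) := by
        unfold poissonLine; gcongr
    _ ≤ _ := by simpa using h1

/-- The decay is only of order 1/|u|, so the conjugate kernel is not integrable. It lies in L^q for
q > 1, and convolutions with it are handled by Hölder's inequality. -/
lemma abs_conjPoissonLine_le {y : ℝ} (hy : 0 < y) (u : ℝ) :
    |conjPoissonLine y u| ≤ (1 + y⁻¹) * (1 + |u|)⁻¹ := by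
  have hpi : Real.pi⁻¹ ≤ 1 := inv_le_one_of_one_le₀ (by linarith [Real.pi_gt_three])
  have h0 : |conjPoissonLine y u| = Real.pi⁻¹ * (|u| / (u ^ 2 + y ^ 2)) := by
    rw [conjPoissonLine, abs_mul, abs_div, abs_of_pos (a := Real.pi⁻¹) (by positivity),
      abs_of_pos (a := u ^ 2 + y ^ 2) (by positivity)]
  have h1 : |u| / (u ^ 2 + y ^ 2) ≤ (1 + y⁻¹) * (1 + |u|)⁻¹ := by
    rw [← div_eq_mul_inv, div_le_div_iff₀ (by positivity) (by positivity)]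
    have h2 : (1 + y⁻¹) * (u ^ 2 + y ^ 2) = u ^ 2 + y ^ 2 + y⁻¹ * (|u| ^ 2 + y ^ 2) := by
      rw [sq_abs]; ring
    rw [h2]
    have h3 : |u| ≤ y⁻¹ * (|u| ^ 2 + y ^ 2) := by
      rw [inv_mul_eq_div, le_div_iff₀ hy]
      nlinarith [sq_nonneg (|u| - y), abs_nonneg u]
    nlinarith [sq_nonneg y, sq_abs u, abs_nonneg u]
  rw [h0]
  calc _ ≤ 1 * (|u| / (u ^ 2 + y ^ 2)) := by gcongr
    _ ≤ _ := by simpa using h1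

lemma memLp_poissonLine {y q : ℝ} (hy : 0 < y) (hq : 1 < q) :
    MemLp (poissonLine y) (ENNReal.ofReal q) :=
  memLp_of_le_inv_one_add_abs (measurable_poissonLine y) (abs_poissonLine_le hy) hq

lemma memLp_conjPoissonLine {y q : ℝ} (hy : 0 < y) (hq : 1 < q) :
    MemLp (conjPoissonLine y) (ENNReal.ofReal q) :=
  memLp_of_le_inv_one_add_abs (measurable_conjPoissonLine y) (abs_conjPoissonLine_le hy) hq

/-! ### Convolution of L^p functions with L^q kernels -/

section Holder

variable {p q : ℝ≥0∞} [p.HolderConjugate q] {k : ℝ → ℝ} {f : ℝ → ℂ}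

lemma memLp_kernel_shift (hk : MemLp k q) (x : ℝ) :
    MemLp (fun t => ((k (x - t) : ℝ) : ℂ)) q :=
  (hk.comp_measurePreserving (Measure.measurePreserving_sub_left volume x)).ofReal

lemma integrable_kernel_mul (hk : MemLp k q) (hf : MemLp f p) (x : ℝ) :
    Integrable (fun t => ((k (x - t) : ℝ) : ℂ) * f t) :=
  have : q.HolderConjugate p := ENNReal.HolderConjugate.symm
  (memLp_kernel_shift hk x).integrable_mul hf

lemma lintegral_kernel_mul_le (hk : MemLp k q) (hf : AEStronglyMeasurable f) (x : ℝ) :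
    ∫⁻ t, ‖((k (x - t) : ℝ) : ℂ) * f t‖ₑ ≤ eLpNorm k q * eLpNorm f p := by
  have : q.HolderConjugate p := ENNReal.HolderConjugate.symm
  have h1 := eLpNorm_smul_le_mul_eLpNorm (μ := volume) (p := q) (q := p) (r := 1) hf
    (memLp_kernel_shift hk x).1
  have h2 : eLpNorm (fun t => ((k (x - t) : ℝ) : ℂ)) q volume = eLpNorm k q := by
    rw [← eLpNorm_comp_measurePreserving hk.1 (Measure.measurePreserving_sub_left volume x)]
    exact eLpNorm_congr_norm_ae (Eventually.of_forall fun t => by simp)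
  rw [h2, eLpNorm_one_eq_lintegral_enorm] at h1
  exact h1

lemma enorm_kernelConv_le (hk : MemLp k q) (hf : AEStronglyMeasurable f) (x : ℝ) :
    ‖kernelConv k f x‖ₑ ≤ eLpNorm k q * eLpNorm f p :=
  (enorm_integral_le_lintegral_enorm _).trans (lintegral_kernel_mul_le hk hf x)

lemma kernelConv_sub (hk : MemLp k q) {g : ℝ → ℂ} (hf : MemLp f p) (hg : MemLp g p) (x : ℝ) :
    kernelConv k (f - g) x = kernelConv k f x - kernelConv k g x := by
  simp only [kernelConv, Pi.sub_apply, mul_sub]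
  exact integral_sub (integrable_kernel_mul hk hf x) (integrable_kernel_mul hk hg x)

lemma kernelConv_add (hk : MemLp k q) {g : ℝ → ℂ} (hf : MemLp f p) (hg : MemLp g p) (x : ℝ) :
    kernelConv k (f + g) x = kernelConv k f x + kernelConv k g x := by
  simp only [kernelConv, Pi.add_apply, mul_add]
  exact integral_add (integrable_kernel_mul hk hf x) (integrable_kernel_mul hk hg x)

/-- Convolution with an `L^q` kernel turns `L^p` convergence into pointwise convergence. -/
lemma tendsto_kernelConv_of_eLpNorm {ι : Type*} {l : Filter ι} (hk : MemLp k q) {F : ι → ℝ → ℂ}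
    (hF : ∀ i, MemLp (F i) p) (hf : MemLp f p)
    (h : Tendsto (fun i => eLpNorm (F i - f) p volume) l (𝓝 0)) (x : ℝ) :
    Tendsto (fun i => kernelConv k (F i) x) l (𝓝 (kernelConv k f x)) := by
  rw [tendsto_iff_edist_tendsto_0]
  have h0 : Tendsto (fun i => eLpNorm k q volume * eLpNorm (F i - f) p volume) l (𝓝 0) := by
    simpa using ENNReal.Tendsto.const_mul h (Or.inr hk.2.ne)
  refine tendsto_of_tendsto_of_tendsto_of_le_of_le tendsto_const_nhds h0 (fun _ => zero_le) ?_
  intro i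
  simp only [edist_eq_enorm_sub]
  rw [← kernelConv_sub hk (hF i) hf]
  exact enorm_kernelConv_le hk ((hF i).sub hf).1 x

end Holder

/-- The equality holds at every point, so representatives may be exchanged inside pointwise
identities. -/
lemma kernelConv_congr (k : ℝ → ℝ) {f g : ℝ → ℂ} (h : f =ᵐ[volume] g) :
    kernelConv k f = kernelConv k g := by
  funext x
  exact integral_congr_ae (h.mono fun t ht => by simp only [ht])

lemma kernelConv_smul (k : ℝ → ℝ) (c : ℂ) (f : ℝ → ℂ) (x : ℝ) :
    kernelConv k (fun t => c * f t) x = c * kernelConv k f x := by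
  simp only [kernelConv, ← integral_const_mul]
  congr 1; funext t; ring

lemma stronglyMeasurable_kernelConv {k : ℝ → ℝ} (hk : Measurable k) {f : ℝ → ℂ}
    (hf : AEStronglyMeasurable f) : StronglyMeasurable (kernelConv k f) := by
  rw [kernelConv_congr k hf.ae_eq_mk]
  refine StronglyMeasurable.integral_prod_right (f := fun x t => ((k (x - t) : ℝ) : ℂ) * hf.mk f t) ?_
  have := hf.stronglyMeasurable_mk.measurable
  refine Measurable.stronglyMeasurable ?_
  unfold Function.uncurry
  fun_prop

/-! ### Jensen's inequality and the L^p contraction by Poisson means -/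

/-- Jensen's inequality for powers, without normalisation of the measure. -/
lemma lintegral_rpow_le_measure_univ {α : Type*} [MeasurableSpace α] (μ : Measure α)
    {p q : ℝ} (hpq : p.HolderConjugate q) {h : α → ℝ≥0∞} (hh : AEMeasurable h μ) :
    (∫⁻ a, h a ∂μ) ^ p ≤ μ univ ^ (p - 1) * ∫⁻ a, h a ^ p ∂μ := by
  have h1 := ENNReal.lintegral_mul_le_Lp_mul_Lq μ hpq hh (aemeasurable_const (b := (1 : ℝ≥0∞)))
  simp only [Pi.mul_apply, mul_one, ENNReal.one_rpow, lintegral_const, one_mul] at h1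
  calc (∫⁻ a, h a ∂μ) ^ p ≤ ((∫⁻ a, h a ^ p ∂μ) ^ (1 / p) * μ univ ^ (1 / q)) ^ p := by
        gcongr; exact hpq.nonneg
    _ = _ := by
        rw [ENNReal.mul_rpow_of_nonneg _ _ hpq.nonneg, ← ENNReal.rpow_mul, ← ENNReal.rpow_mul,
          one_div_mul_cancel hpq.ne_zero, ENNReal.rpow_one, mul_comm]
        congr 2
        have h2 := hpq.inv_add_inv_eq_one
        have h3 := hpq.ne_zero
        rw [one_div, eq_sub_of_add_eq' h2]; field_simp

lemma eLpNorm_ofReal_rpow {α E : Type*} [MeasurableSpace α] [NormedAddCommGroup E]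
    {μ : Measure α} {p : ℝ} (hp : 0 < p) (f : α → E) :
    eLpNorm f (ENNReal.ofReal p) μ ^ p = ∫⁻ x, ‖f x‖ₑ ^ p ∂μ := by
  rw [eLpNorm_eq_lintegral_rpow_enorm_toReal (by simpa using hp) ENNReal.ofReal_ne_top,
    ENNReal.toReal_ofReal hp.le, ← ENNReal.rpow_mul, one_div_mul_cancel hp.ne', ENNReal.rpow_one]

/-- Poisson means contract `L^p`: a pointwise bound by Jensen's inequality. -/
lemma lintegral_poissonLine_rpow_le {p q : ℝ} (hpq : p.HolderConjugate q) {y : ℝ} (hy : 0 < y)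
    {h : ℝ → ℝ≥0∞} (hh : AEMeasurable h) (x : ℝ) :
    (∫⁻ t, ENNReal.ofReal (poissonLine y (x - t)) * h t) ^ p ≤
      ∫⁻ t, ENNReal.ofReal (poissonLine y (x - t)) * h t ^ p := by
  have hm : Measurable fun t => ENNReal.ofReal (poissonLine y (x - t)) :=
    ((measurable_poissonLine y).comp (measurable_const.sub measurable_id)).ennreal_ofReal
  have hac := withDensity_absolutelyContinuous (volume : Measure ℝ)
    (fun t => ENNReal.ofReal (poissonLine y (x - t)))
  have h1 := lintegral_rpow_le_measure_univ (volume.withDensity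
    fun t => ENNReal.ofReal (poissonLine y (x - t))) hpq (hh.mono_ac hac)
  rw [lintegral_withDensity_eq_lintegral_mul₀ hm.aemeasurable hh,
    lintegral_withDensity_eq_lintegral_mul₀ hm.aemeasurable (hh.pow_const p),
    withDensity_apply _ MeasurableSet.univ, Measure.restrict_univ,
    lintegral_sub_left_eq_self (fun u => ENNReal.ofReal (poissonLine y u)) x,
    lintegral_poissonLine hy, ENNReal.one_rpow, one_mul] at h1
  exact h1

lemma lintegral_lintegral_poissonLine {y : ℝ} (hy : 0 < y) {h : ℝ → ℝ≥0∞} (hh : AEMeasurable h) :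
    ∫⁻ x, ∫⁻ t, ENNReal.ofReal (poissonLine y (x - t)) * h t = ∫⁻ t, h t := by
  rw [lintegral_lintegral_swap]
  · refine lintegral_congr fun t => ?_
    have hm : AEMeasurable fun x => ENNReal.ofReal (poissonLine y (x - t)) :=
      ((measurable_poissonLine y).comp (measurable_id.sub_const t)).ennreal_ofReal.aemeasurable
    rw [lintegral_mul_const'' _ hm, lintegral_sub_right_eq_self (fun u => ENNReal.ofReal (poissonLine y u)) t,
      lintegral_poissonLine hy, one_mul]
  · exact ((measurable_poissonLine y).comp
      (measurable_fst.sub measurable_snd)).ennreal_ofReal.aemeasurable.mul hh.comp_snd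

lemma enorm_kernelConv_poissonLine_le {y : ℝ} (hy : 0 < y) (f : ℝ → ℂ) (x : ℝ) :
    ‖kernelConv (poissonLine y) f x‖ₑ ≤ ∫⁻ t, ENNReal.ofReal (poissonLine y (x - t)) * ‖f t‖ₑ := by
  refine (enorm_integral_le_lintegral_enorm _).trans_eq (lintegral_congr fun t => ?_)
  rw [enorm_mul, ← ofReal_norm (Complex.ofReal _), Complex.norm_real,
    Real.norm_of_nonneg (poissonLine_nonneg hy _)]

/-- Jensen's inequality for the probability measure P_y(x - t) dt, followed by Tonelli in x. -/
lemma eLpNorm_kernelConv_poissonLine_le {p : ℝ} (hp : 1 < p) {y : ℝ} (hy : 0 < y) {f : ℝ → ℂ}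
    (hf : AEStronglyMeasurable f) :
    eLpNorm (kernelConv (poissonLine y) f) (ENNReal.ofReal p) ≤ eLpNorm f (ENNReal.ofReal p) := by
  have hp0 : 0 < p := by linarith
  rw [← ENNReal.rpow_le_rpow_iff hp0, eLpNorm_ofReal_rpow hp0, eLpNorm_ofReal_rpow hp0]
  calc ∫⁻ x, ‖kernelConv (poissonLine y) f x‖ₑ ^ p
      ≤ ∫⁻ x, ∫⁻ t, ENNReal.ofReal (poissonLine y (x - t)) * ‖f t‖ₑ ^ p :=
        lintegral_mono fun x => (ENNReal.rpow_le_rpow (enorm_kernelConv_poissonLine_le hy f x)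
          hp0.le).trans (lintegral_poissonLine_rpow_le (Real.HolderConjugate.conjExponent hp) hy
            hf.enorm x)
    _ = _ := lintegral_lintegral_poissonLine hy (hf.enorm.pow_const p)

lemma memLp_kernelConv_poissonLine {p : ℝ} (hp : 1 < p) {y : ℝ} (hy : 0 < y) {f : ℝ → ℂ}
    (hf : MemLp f (ENNReal.ofReal p)) :
    MemLp (kernelConv (poissonLine y) f) (ENNReal.ofReal p) :=
  ⟨(stronglyMeasurable_kernelConv (measurable_poissonLine y) hf.1).aestronglyMeasurable,
    (eLpNorm_kernelConv_poissonLine_le hp hy hf.1).trans_lt hf.2⟩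

/-! ### Fubini and associativity of convolution -/

lemma aestronglyMeasurable_kernel_mul_kernel_mul {k l : ℝ → ℝ} (hkm : Measurable k)
    (hlm : Measurable l) {f : ℝ → ℂ} (hf : AEStronglyMeasurable f) (x : ℝ) :
    AEStronglyMeasurable (Function.uncurry fun t s : ℝ =>
      ((k (x - t) : ℝ) : ℂ) * (((l (t - s) : ℝ) : ℂ) * f s)) (volume.prod volume) := by
  have h1 : Measurable fun z : ℝ × ℝ => ((k (x - z.1) : ℝ) : ℂ) :=
    Complex.measurable_ofReal.comp (hkm.comp (measurable_const.sub measurable_fst))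
  have h2 : Measurable fun z : ℝ × ℝ => ((l (z.1 - z.2) : ℝ) : ℂ) :=
    Complex.measurable_ofReal.comp (hlm.comp (measurable_fst.sub measurable_snd))
  exact h1.aestronglyMeasurable.mul (h2.aestronglyMeasurable.mul hf.comp_snd)

lemma enorm_ofReal_complex (r : ℝ) : ‖(r : ℂ)‖ₑ = ‖r‖ₑ := by
  rw [← ofReal_norm, ← ofReal_norm, Complex.norm_real]

lemma lintegral_kernel_mul_kernel_mul {k l : ℝ → ℝ} (hkm : Measurable k)
    (hlm : Measurable l) {f : ℝ → ℂ} (hf : AEStronglyMeasurable f) (x : ℝ) :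
    ∫⁻ z, ‖(Function.uncurry fun t s : ℝ =>
      ((k (x - t) : ℝ) : ℂ) * (((l (t - s) : ℝ) : ℂ) * f s)) z‖ₑ ∂(volume.prod volume) =
    ∫⁻ t, ‖k (x - t)‖ₑ * ∫⁻ s, ‖((l (t - s) : ℝ) : ℂ) * f s‖ₑ := by
  rw [lintegral_prod _ (aestronglyMeasurable_kernel_mul_kernel_mul hkm hlm hf x).enorm]
  refine lintegral_congr fun t => ?_
  simp only [Function.uncurry, enorm_mul ((k (x - t) : ℝ) : ℂ), enorm_ofReal_complex]
  have h : AEMeasurable fun s => ‖((l (t - s) : ℝ) : ℂ) * f s‖ₑ :=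
    ((Complex.measurable_ofReal.comp
      (hlm.comp (measurable_id.const_sub t))).aestronglyMeasurable.mul hf).enorm
  rw [lintegral_const_mul'' _ h]

/-- Hölder bounds the inner integral uniformly in t, and the outer kernel is integrable. This covers
P_r * (Q_s * f). -/
lemma integrable_kernel_mul_kernel_mul {p q : ℝ≥0∞} [p.HolderConjugate q] {k l : ℝ → ℝ}
    (hkm : Measurable k) (hlm : Measurable l)
    (hk : Integrable k) (hl : MemLp l q) {f : ℝ → ℂ} (hf : MemLp f p) (x : ℝ) :
    Integrable (Function.uncurry fun t s : ℝ =>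
      ((k (x - t) : ℝ) : ℂ) * (((l (t - s) : ℝ) : ℂ) * f s)) (volume.prod volume) := by
  refine ⟨aestronglyMeasurable_kernel_mul_kernel_mul hkm hlm hf.1 x, ?_⟩
  rw [hasFiniteIntegral_iff_enorm, lintegral_kernel_mul_kernel_mul hkm hlm hf.1]
  have hfin : (∫⁻ t, ‖k t‖ₑ) * (eLpNorm l q volume * eLpNorm f p volume) < ∞ :=
    ENNReal.mul_lt_top (hasFiniteIntegral_iff_enorm.1 hk.2)
      (ENNReal.mul_lt_top hl.eLpNorm_lt_top hf.eLpNorm_lt_top)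
  refine lt_of_le_of_lt ?_ hfin
  calc _ ≤ ∫⁻ t, ‖k (x - t)‖ₑ * (eLpNorm l q volume * eLpNorm f p volume) := by
        gcongr with t
        exact lintegral_kernel_mul_le hl hf.1 t
    _ = (∫⁻ t, ‖k t‖ₑ) * (eLpNorm l q volume * eLpNorm f p volume) := by
        have hkx : Measurable fun t => ‖k (x - t)‖ₑ := (hkm.comp (measurable_id.const_sub x)).enorm
        rw [lintegral_mul_const _ hkx, lintegral_sub_left_eq_self (fun t => ‖k t‖ₑ) x]

/-- The outer kernel need not be integrable here, as in Q_s * (P_r * f). Instead the inner integral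
is in L^p by Jensen, and Hölder is applied outside. -/
lemma integrable_kernel_mul_poissonLine_mul {p q : ℝ} (hpq : p.HolderConjugate q) {k : ℝ → ℝ}
    (hkm : Measurable k) (hk : MemLp k (ENNReal.ofReal q)) {y : ℝ} (hy : 0 < y)
    {f : ℝ → ℂ} (hf : MemLp f (ENNReal.ofReal p)) (x : ℝ) :
    Integrable (Function.uncurry fun t s : ℝ =>
      ((k (x - t) : ℝ) : ℂ) * (((poissonLine y (t - s) : ℝ) : ℂ) * f s)) (volume.prod volume) := by
  have hlm := measurable_poissonLine y
  refine ⟨aestronglyMeasurable_kernel_mul_kernel_mul hkm hlm hf.1 x, ?_⟩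
  rw [hasFiniteIntegral_iff_enorm, lintegral_kernel_mul_kernel_mul hkm hlm hf.1]
  set A : ℝ → ℝ≥0∞ := fun t => ∫⁻ s, ENNReal.ofReal (poissonLine y (t - s)) * ‖f s‖ₑ
  have hA : ∀ t, ∫⁻ s, ‖((poissonLine y (t - s) : ℝ) : ℂ) * f s‖ₑ = A t := fun t => by
    simp only [A, enorm_mul, enorm_ofReal_complex,
      Real.enorm_of_nonneg (poissonLine_nonneg hy _)]
  have hAm : AEMeasurable A := by
    have h2 : Measurable fun z : ℝ × ℝ => ENNReal.ofReal (poissonLine y (z.1 - z.2)) :=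
      (hlm.comp (measurable_fst.sub measurable_snd)).ennreal_ofReal
    exact (h2.aemeasurable.mul hf.1.enorm.comp_snd).lintegral_prod_right'
  simp only [hA]
  have hkx : AEMeasurable fun t => ‖k (x - t)‖ₑ :=
    (hkm.comp (measurable_id.const_sub x)).enorm.aemeasurable
  refine (ENNReal.lintegral_mul_le_Lp_mul_Lq volume hpq.symm hkx hAm).trans_lt ?_
  refine ENNReal.mul_lt_top (ENNReal.rpow_lt_top_of_nonneg (by simpa using hpq.symm.nonneg) ?_)
    (ENNReal.rpow_lt_top_of_nonneg (by simpa using hpq.nonneg) ?_)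
  · rw [lintegral_sub_left_eq_self (fun t => ‖k t‖ₑ ^ q) x, ← eLpNorm_ofReal_rpow hpq.symm.pos]
    exact ENNReal.rpow_ne_top_of_nonneg hpq.symm.nonneg hk.eLpNorm_ne_top
  · refine ne_top_of_le_ne_top ?_ (lintegral_mono fun t =>
      lintegral_poissonLine_rpow_le hpq hy hf.1.enorm t)
    rw [lintegral_lintegral_poissonLine hy (hf.1.enorm.pow_const p),
      ← eLpNorm_ofReal_rpow hpq.pos]
    exact ENNReal.rpow_ne_top_of_nonneg hpq.nonneg hf.eLpNorm_ne_top

/-- Associativity of convolution. -/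
lemma kernelConv_kernelConv {k l m : ℝ → ℝ} {f : ℝ → ℂ} {x : ℝ}
    (h : Integrable (Function.uncurry fun t s : ℝ =>
      ((k (x - t) : ℝ) : ℂ) * (((l (t - s) : ℝ) : ℂ) * f s)) (volume.prod volume))
    (hm : ∀ u, ∫ t, k (u - t) * l t = m u) :
    kernelConv k (kernelConv l f) x = kernelConv m f x := by
  simp only [kernelConv, ← integral_const_mul]
  rw [integral_integral_swap h]
  refine integral_congr_ae (Eventually.of_forall fun s => ?_)
  simp only [← mul_assoc, integral_mul_const]
  congr 1
  rw [← hm, ← integral_add_right_eq_self _ s]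
  simp only [← Complex.ofReal_mul, add_sub_cancel_right, sub_sub, add_comm s]
  exact integral_ofReal

/-! ### Contour integration and the semigroup law -/

open Complex in
/-- The integral over a horizontal line of a function that is holomorphic above the line and decays
faster than `1 / |z|` vanishes. -/
lemma integral_horizontal_eq_zero {G : ℂ → ℂ} {y : ℝ}
    (hG : ∀ z : ℂ, y ≤ z.im → DifferentiableAt ℂ G z) {C a R₀ : ℝ} (ha : 1 < a) (hR₀ : 0 < R₀)
    (hb : ∀ z : ℂ, y ≤ z.im → R₀ ≤ ‖z‖ → ‖G z‖ ≤ C * ‖z‖ ^ (-a)) :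
    ∫ x : ℝ, G (x + y * I) = 0 := by
  -- Without integrability the Bochner integral is 0 by convention.
  by_cases hint : Integrable fun x : ℝ => G (x + y * I)
  swap
  · exact integral_undef hint
  have hlim : Tendsto (fun R : ℝ => ∫ x in (-R)..R, G (x + y * I)) atTop
      (𝓝 (∫ x : ℝ, G (x + y * I))) :=
    intervalIntegral_tendsto_integral hint tendsto_neg_atTop_atBot tendsto_id
  refine tendsto_nhds_unique hlim ?_
  have hC : 0 ≤ C := by
    obtain ⟨z, hz, hz'⟩ : ∃ z : ℂ, y ≤ z.im ∧ R₀ ≤ ‖z‖ :=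
      ⟨((|y| + R₀ : ℝ) : ℂ) * I, by simpa using (le_abs_self y).trans (by linarith), by
        simp only [norm_mul, norm_real, norm_I, mul_one, Real.norm_eq_abs]
        exact (le_abs_self _).trans' (by linarith [abs_nonneg y])⟩
    have := (norm_nonneg _).trans (hb z hz hz')
    exact nonneg_of_mul_nonneg_left this (Real.rpow_pos_of_pos (hR₀.trans_le hz') _)
  -- Cauchy's theorem on the rectangle [-R, R] × [y, R]. Each of the three other sides has length at
  -- most 2R and carries |G| ≤ C R^(-a), hence the factor 6.
  have key : ∀ R : ℝ, max R₀ |y| ≤ R →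
      ‖∫ x in (-R)..R, G (x + y * I)‖ ≤ 6 * C * R ^ (1 - a) := by
    intro R hR
    have hR1 : R₀ ≤ R := (le_max_left _ _).trans hR
    have hR2 : |y| ≤ R := (le_max_right _ _).trans hR
    have hRp : 0 < R := hR₀.trans_le hR1
    have hyR : y ≤ R := (le_abs_self y).trans hR2
    have hbd : ∀ z : ℂ, y ≤ z.im → R ≤ ‖z‖ → ‖G z‖ ≤ C * R ^ (-a) := fun z h1 h2 =>
      (hb z h1 (hR1.trans h2)).trans (mul_le_mul_of_nonneg_left
        (Real.rpow_le_rpow_of_nonpos hRp h2 (by linarith)) hC)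
    have hrect := integral_boundary_rect_eq_zero_of_differentiableOn G
      (((-R : ℝ) : ℂ) + y * I) ((R : ℂ) + R * I) (fun z hz => by
        refine (hG z ?_).differentiableWithinAt
        have := hz.2
        simp only [mem_preimage, add_im, ofReal_im, mul_im, ofReal_re, I_im, I_re, mul_one,
          mul_zero, add_zero, zero_add, uIcc_of_le hyR] at this
        exact this.1)
    simp only [add_re, add_im, ofReal_im, ofReal_re, mul_re, mul_im, I_im, I_re, mul_one,
      mul_zero, add_zero, zero_add, sub_self] at hrect
    have htop : ‖∫ x in (-R)..R, G (x + R * I)‖ ≤ C * R ^ (-a) * |R - -R| := by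
      refine intervalIntegral.norm_integral_le_of_norm_le_const fun x _ => hbd _ (by simpa) ?_
      have := abs_im_le_norm ((x : ℂ) + R * I)
      simpa [abs_of_pos hRp] using this
    have hside : ∀ s : ℝ, |s| = R →
        ‖∫ t in y..R, G (s + t * I)‖ ≤ C * R ^ (-a) * |R - y| := by
      intro s hs
      refine intervalIntegral.norm_integral_le_of_norm_le_const fun t ht => hbd _ ?_ ?_
      · rw [uIoc_of_le hyR] at ht
        simpa using ht.1.le
      · have := abs_re_le_norm ((s : ℂ) + t * I)
        simpa [hs] using this
    have h1 := hside R (abs_of_pos hRp)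
    have h2 := hside (-R) (by rw [abs_neg, abs_of_pos hRp])
    have h3 : |R - y| ≤ 2 * R := by
      rw [abs_of_nonneg (by linarith)]; linarith [neg_abs_le y]
    have h4 : |R - -R| = 2 * R := by rw [abs_of_nonneg (by linarith)]; ring
    have h5 : C * R ^ (-a) * (2 * R) = 2 * C * R ^ (1 - a) := by
      rw [sub_eq_add_neg, Real.rpow_add hRp, Real.rpow_one]; ring
    have h6 : C * R ^ (-a) * |R - y| ≤ C * R ^ (-a) * (2 * R) := by gcongr
    rw [h4] at htop
    have heq : ∫ x in (-R)..R, G (x + y * I) = (∫ x in (-R)..R, G (x + R * I))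
        - I • (∫ t in y..R, G (R + t * I)) + I • ∫ t in y..R, G ((-R : ℝ) + t * I) := by
      linear_combination hrect
    rw [heq]
    refine (norm_add_le _ _).trans ((add_le_add_left (norm_sub_le _ _) _).trans ?_)
    rw [norm_smul, norm_smul, norm_I, one_mul, one_mul]
    linarith
  have h0 : Tendsto (fun R : ℝ => 6 * C * R ^ (1 - a)) atTop (𝓝 0) := by
    simpa [neg_sub] using (tendsto_rpow_neg_atTop (y := a - 1) (by linarith)).const_mul (6 * C)
  exact squeeze_zero_norm' ((eventually_ge_atTop _).mono key) h0

open Complex in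
lemma norm_sub_ge_half {z w : ℂ} (h : 2 * ‖w‖ ≤ ‖z‖) : ‖z‖ / 2 ≤ ‖z - w‖ := by
  linarith [norm_sub_norm_le z w]

open Complex in
/-- The Poisson formula for `z ↦ 1 / (z + i s)`. -/
lemma integral_poissonLine_mul_inv {y s : ℝ} (hy : 0 < y) (hs : 0 < s) (x : ℝ) :
    Integrable (fun t : ℝ => (poissonLine y (x - t) : ℂ) * ((t : ℂ) + s * I)⁻¹) ∧
    ∫ t : ℝ, (poissonLine y (x - t) : ℂ) * ((t : ℂ) + s * I)⁻¹ = ((x : ℂ) + (y + s : ℝ) * I)⁻¹ := by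
  have hne : ∀ t : ℝ, ∀ r : ℝ, r ≠ 0 → (t : ℂ) + r * I ≠ 0 := fun t r hr h => hr (by
    simpa using congrArg Complex.im h)
  set c : ℂ := (x : ℂ) + (y + s : ℝ) * I with hc
  have hc0 : c ≠ 0 := hne _ _ (by linarith)
  have hint0 : Integrable fun t : ℝ => (poissonLine y (x - t) : ℂ) :=
    ((integrable_poissonLine hy).comp_sub_left x).ofReal
  have hint : Integrable fun t : ℝ => (poissonLine y (x - t) : ℂ) * ((t : ℂ) + s * I)⁻¹ := by
    refine hint0.mul_bdd (c := s⁻¹) (by fun_prop) (Eventually.of_forall fun t => ?_)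
    rw [norm_inv]
    refine inv_anti₀ hs ?_
    have := abs_im_le_norm ((t : ℂ) + s * I)
    simpa [abs_of_pos hs] using this
  refine ⟨hint, ?_⟩
  have hone : ∫ t : ℝ, (poissonLine y (x - t) : ℂ) = 1 := by
    have h : ∫ t : ℝ, (poissonLine y (x - t) : ℂ) = ((∫ t : ℝ, poissonLine y (x - t) : ℝ) : ℂ) :=
      integral_ofReal
    rw [h, integral_sub_left_eq_self (poissonLine y) volume x,
      integral_poissonLine hy, ofReal_one]
  -- Both poles, -is and x - iy, lie below the real line, and the product decays like |z|^(-2).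
  have hz : ∫ t : ℝ, (fun z : ℂ => (z + s * I)⁻¹ * (z - (x - y * I))⁻¹) (t + (0 : ℝ) * I) = 0 := by
    have hden : ∀ z : ℂ, 0 ≤ z.im → z + s * I ≠ 0 ∧ z - (x - y * I) ≠ 0 := fun z hz => by
      constructor <;> intro h <;> have := congrArg Complex.im h <;> simp at this <;> linarith
    refine integral_horizontal_eq_zero (y := 0)
      (G := fun z : ℂ => (z + s * I)⁻¹ * (z - (x - y * I))⁻¹) (C := 4) (a := 2)
      (R₀ := 2 * ‖(s * I : ℂ)‖ + 2 * ‖(x - y * I : ℂ)‖) (fun z hz => ?_) one_lt_two ?_ ?_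
    · have h1 : DifferentiableAt ℂ (fun z : ℂ => z + s * I) z := by fun_prop
      have h2 : DifferentiableAt ℂ (fun z : ℂ => z - (x - y * I)) z := by fun_prop
      exact (h1.inv (hden z hz).1).mul (h2.inv (hden z hz).2)
    · have : 0 < ‖(s * I : ℂ)‖ := norm_pos_iff.2 (by simpa using hs.ne')
      positivity
    · intro z hzi hz
      have hsI : 0 < ‖(s * I : ℂ)‖ := norm_pos_iff.2 (by simpa using hs.ne')
      have hzp : 0 < ‖z‖ := by linarith [norm_nonneg (x - y * I : ℂ)]
      have h1 : ‖z‖ / 2 ≤ ‖z + s * I‖ := by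
        have := norm_sub_ge_half (z := z) (w := -(s * I)) (by
          rw [norm_neg]; linarith [norm_nonneg (x - y * I : ℂ)])
        rwa [sub_neg_eq_add] at this
      have h2 : ‖z‖ / 2 ≤ ‖z - (x - y * I)‖ := norm_sub_ge_half (by linarith)
      rw [norm_mul, norm_inv, norm_inv]
      calc ‖z + s * I‖⁻¹ * ‖z - (x - y * I)‖⁻¹ ≤ (‖z‖ / 2)⁻¹ * (‖z‖ / 2)⁻¹ := by gcongr
        _ = 4 * ‖z‖ ^ (-2 : ℝ) := by
          rw [Real.rpow_neg hzp.le, Real.rpow_two]; field_simp; norm_num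
  -- P_y(x - t) extends meromorphically in t with one pole in the upper half-plane, at x + iy, where
  -- (t + is)⁻¹ takes the value c⁻¹. Subtracting c⁻¹ cancels that pole and leaves a multiple of the
  -- function in `hz`.
  have hpt : ∀ t : ℝ, (poissonLine y (x - t) : ℂ) * ((t : ℂ) + s * I)⁻¹ =
      (poissonLine y (x - t) : ℂ) * c⁻¹ + (-(y / Real.pi * c⁻¹)) *
        (fun z : ℂ => (z + s * I)⁻¹ * (z - (x - y * I))⁻¹) (t + (0 : ℝ) * I) := by
    intro t
    have h1 := hne t s hs.ne'
    have h2 : (t : ℂ) - x + y * I ≠ 0 := by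
      have := hne (t - x) y hy.ne'
      rwa [ofReal_sub] at this
    have h3 : (t : ℂ) - x - y * I ≠ 0 := by
      have := hne (t - x) (-y) (neg_ne_zero.2 hy.ne')
      rwa [ofReal_sub, ofReal_neg, neg_mul, ← sub_eq_add_neg] at this
    have h4 : (poissonLine y (x - t) : ℂ) =
        (y / Real.pi) * (((t : ℂ) - x + y * I)⁻¹ * ((t : ℂ) - x - y * I)⁻¹) := by
      have h5 : ((t : ℂ) - x + y * I) * ((t : ℂ) - x - y * I) = ((x : ℂ) - t) ^ 2 + y ^ 2 := by
        ring_nf; rw [I_sq]; ring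
      rw [← mul_inv, h5, poissonLine]; push_cast; field_simp
    have h5 : (t : ℂ) + (0 : ℝ) * I - (x - y * I) = t - x + y * I := by push_cast; ring
    have h6 : (t : ℂ) + (0 : ℝ) * I + s * I = t + s * I := by push_cast; ring
    simp only [h4, h5, h6]
    have h7 : (t : ℂ) - x - y * I = (t + s * I) - c := by rw [hc]; push_cast; ring
    have h8 : (t + s * I) - c ≠ 0 := h7 ▸ h3
    rw [h7]
    generalize (t : ℂ) + s * I = w at h1 h8
    have key : (w - c)⁻¹ * w⁻¹ = (w - c)⁻¹ * c⁻¹ - c⁻¹ * w⁻¹ := by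
      field_simp; ring
    linear_combination (y / Real.pi * (↑t - ↑x + ↑y * I)⁻¹ : ℂ) * key
  simp_rw [hpt]
  rw [integral_add (hint0.mul_const _), integral_mul_const, hone, integral_const_mul, hz]
  · simp
  · have : (fun t : ℝ => (-(y / Real.pi * c⁻¹)) *
        (fun z : ℂ => (z + s * I)⁻¹ * (z - (x - y * I))⁻¹) (t + (0 : ℝ) * I)) =
        fun t => (poissonLine y (x - t) : ℂ) * ((t : ℂ) + s * I)⁻¹ -
          (poissonLine y (x - t) : ℂ) * c⁻¹ := by
      funext t; rw [hpt t]; ring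
    rw [this]
    exact hint.sub (hint0.mul_const _)

open Complex in
lemma re_inv_add_mul_I (t s : ℝ) : (((t : ℂ) + s * I)⁻¹).re = Real.pi * conjPoissonLine s t := by
  rw [inv_re, normSq_add_mul_I, conjPoissonLine]
  have := Real.pi_ne_zero
  simp

/-- Semigroup law: `P_y * Q_s = Q_{y + s}`. -/
lemma integral_poissonLine_mul_conjPoissonLine {y s : ℝ} (hy : 0 < y) (hs : 0 < s) (x : ℝ) :
    ∫ t : ℝ, poissonLine y (x - t) * conjPoissonLine s t = conjPoissonLine (y + s) x := by
  obtain ⟨h1, h2⟩ := integral_poissonLine_mul_inv hy hs x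
  have h3 := congrArg Complex.re h2
  rw [re_inv_add_mul_I] at h3
  have h5 : ∀ t : ℝ, ((poissonLine y (x - t) : ℂ) * ((t : ℂ) + s * Complex.I)⁻¹).re =
      Real.pi * (poissonLine y (x - t) * conjPoissonLine s t) := fun t => by
    rw [Complex.re_ofReal_mul, re_inv_add_mul_I]; ring
  have h6 : ∫ t : ℝ, ((poissonLine y (x - t) : ℂ) * ((t : ℂ) + s * Complex.I)⁻¹).re =
      (∫ t : ℝ, (poissonLine y (x - t) : ℂ) * ((t : ℂ) + s * Complex.I)⁻¹).re :=
    integral_re h1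
  simp_rw [h5] at h6
  rw [h3, integral_const_mul] at h6
  exact mul_left_cancel₀ Real.pi_ne_zero h6

/-! ### Holomorphic extension and M. Riesz's inequality for 1 < p ≤ 2 -/

open Complex in
/-- The holomorphic function in the upper half-plane with boundary real part `f`. -/
noncomputable def halfPlaneExtension (f : ℝ → ℝ) (z : ℂ) : ℂ :=
  ∫ t : ℝ, I * (Real.pi * (z - t))⁻¹ * f t

open Complex in
lemma sub_ofReal_ne_zero {z : ℂ} (hz : 0 < z.im) (t : ℝ) : z - t ≠ 0 := fun h => by
  have := congrArg Complex.im h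
  simp at this
  exact hz.ne' this

open Complex in
lemma im_le_norm_sub_ofReal (z : ℂ) (t : ℝ) : z.im ≤ ‖z - t‖ := by
  have := (le_abs_self _).trans (abs_im_le_norm (z - t))
  simpa using this

open Complex in
lemma measurable_halfPlaneExtension_kernel (z : ℂ) :
    Measurable fun t : ℝ => I * (Real.pi * (z - t))⁻¹ := by fun_prop

open Complex in
lemma norm_halfPlaneExtension_kernel (z : ℂ) (t : ℝ) :
    ‖I * (Real.pi * (z - t))⁻¹‖ = Real.pi⁻¹ * ‖z - t‖⁻¹ := by
  rw [norm_mul, norm_I, one_mul, norm_inv, norm_mul, norm_real, mul_inv,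
    Real.norm_of_nonneg Real.pi_pos.le]

open Complex in
lemma integrable_halfPlaneExtension {f : ℝ → ℝ} (hf : Integrable f) {z : ℂ} (hz : 0 < z.im) :
    Integrable fun t : ℝ => I * (Real.pi * (z - t))⁻¹ * f t := by
  refine hf.ofReal.bdd_mul (c := Real.pi⁻¹ * z.im⁻¹)
    (measurable_halfPlaneExtension_kernel z).aestronglyMeasurable
    (Eventually.of_forall fun t => ?_)
  rw [norm_halfPlaneExtension_kernel]
  gcongr
  exact im_le_norm_sub_ofReal z t

open Complex in
lemma differentiableAt_halfPlaneExtension {f : ℝ → ℝ} (hf : Integrable f) {z₀ : ℂ}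
    (hz₀ : 0 < z₀.im) : DifferentiableAt ℂ (halfPlaneExtension f) z₀ := by
  -- On this neighbourhood |z - t| ≥ Im z₀ / 2 for every real t, which supplies the dominating
  -- function.
  have hs : {z : ℂ | z₀.im / 2 < z.im} ∈ 𝓝 z₀ :=
    (isOpen_lt continuous_const continuous_im).mem_nhds (by change z₀.im / 2 < z₀.im; linarith)
  refine (hasDerivAt_integral_of_dominated_loc_of_deriv_le (𝕜 := ℂ)
    (F := fun (z : ℂ) (t : ℝ) => I * (Real.pi * (z - t))⁻¹ * f t)
    (F' := fun (z : ℂ) (t : ℝ) => I * (-Real.pi / (Real.pi * (z - t)) ^ 2) * f t)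
    (bound := fun t => Real.pi⁻¹ * (z₀.im / 2)⁻¹ ^ 2 * ‖f t‖) hs ?_
    (integrable_halfPlaneExtension hf hz₀) ?_ ?_ (hf.norm.const_mul _) ?_).2.differentiableAt
  · exact Eventually.of_forall fun z =>
      (measurable_halfPlaneExtension_kernel z).aestronglyMeasurable.mul
        hf.ofReal.1
  · refine AEStronglyMeasurable.mul ?_ hf.ofReal.1
    have : Measurable fun t : ℝ => I * (-Real.pi / (Real.pi * (z₀ - t)) ^ 2) := by fun_prop
    exact this.aestronglyMeasurable
  · refine Eventually.of_forall fun t z hz => ?_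
    have hz' : z₀.im / 2 ≤ ‖z - t‖ := hz.le.trans (im_le_norm_sub_ofReal z t)
    have h2 : 0 < z₀.im / 2 := by linarith
    have h1 : ‖I * (-(Real.pi : ℂ) / (Real.pi * (z - t)) ^ 2)‖ =
        Real.pi⁻¹ * ‖z - t‖⁻¹ ^ 2 := by
      rw [norm_mul, norm_I, one_mul, norm_div, norm_neg, norm_pow, norm_mul, norm_real,
        Real.norm_of_nonneg Real.pi_pos.le]
      have := h2.trans_le hz'
      field_simp
    rw [norm_mul, h1, norm_real]
    gcongr
  · refine Eventually.of_forall fun t z hz => ?_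
    have hz' : 0 < z.im := lt_trans (by linarith) hz
    have h1 : HasDerivAt (fun z : ℂ => (Real.pi : ℂ) * (z - t)) Real.pi z := by
      simpa using ((hasDerivAt_id z).sub_const (t : ℂ)).const_mul (Real.pi : ℂ)
    have h2 := h1.fun_inv (mul_ne_zero (ofReal_ne_zero.2 Real.pi_ne_zero)
      (sub_ofReal_ne_zero hz' t))
    exact (h2.const_mul I).mul_const _

open Complex in
lemma halfPlaneExtension_kernel_eq {y : ℝ} (hy : 0 < y) (x t : ℝ) :
    I * (Real.pi * ((x + y * I : ℂ) - t))⁻¹ =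
      (poissonLine y (x - t) : ℂ) + I * (conjPoissonLine y (x - t) : ℂ) := by
  have h1 : (x + y * I : ℂ) - t ≠ 0 := sub_ofReal_ne_zero (by simpa using hy) t
  have h2 : ((x : ℂ) - t) - y * I ≠ 0 := fun h => by
    have := congrArg Complex.im h
    simp at this
    exact hy.ne' this
  have h3 : ((x : ℂ) - t) ^ 2 + (y : ℂ) ^ 2 = ((x + y * I : ℂ) - t) * (((x : ℂ) - t) - y * I) := by
    ring_nf; rw [I_sq]; ring
  have hpi : (Real.pi : ℂ) ≠ 0 := ofReal_ne_zero.2 Real.pi_ne_zero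
  rw [poissonLine, conjPoissonLine]
  push_cast
  rw [h3, mul_inv, div_eq_mul_inv, div_eq_mul_inv, mul_inv]
  have h4 : (((x : ℂ) - t) - y * I)⁻¹ * (((x : ℂ) - t) - y * I) = 1 := inv_mul_cancel₀ h2
  have h5 : (y : ℂ) + I * (x - t) = I * (((x : ℂ) - t) - y * I) := by
    ring_nf; rw [I_sq]; ring
  linear_combination (-((Real.pi : ℂ)⁻¹ * ((x + y * I : ℂ) - t)⁻¹ * I)) * h4 -
    ((Real.pi : ℂ)⁻¹ * ((x + y * I : ℂ) - t)⁻¹ * (((x : ℂ) - t) - y * I)⁻¹) * h5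

open Complex in
lemma halfPlaneExtension_re_im {f : ℝ → ℝ} (hf : Integrable f) {y : ℝ} (hy : 0 < y) (x : ℝ) :
    (halfPlaneExtension f (x + y * I)).re = ∫ t, poissonLine y (x - t) * f t ∧
    (halfPlaneExtension f (x + y * I)).im = ∫ t, conjPoissonLine y (x - t) * f t := by
  have hi := integrable_halfPlaneExtension hf (z := x + y * I) (by simpa using hy)
  have h1 : (∫ t : ℝ, (I * (Real.pi * ((x + y * I : ℂ) - t))⁻¹ * f t).re) =
    (halfPlaneExtension f (x + y * I)).re := integral_re hi
  have h2 : (∫ t : ℝ, (I * (Real.pi * ((x + y * I : ℂ) - t))⁻¹ * f t).im) =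
    (halfPlaneExtension f (x + y * I)).im := integral_im hi
  rw [← h1, ← h2]
  constructor <;> refine integral_congr_ae (Eventually.of_forall fun t => ?_) <;>
    simp only [halfPlaneExtension_kernel_eq hy] <;> simp

lemma kernelConv_ofReal (k f : ℝ → ℝ) (x : ℝ) :
    kernelConv k (fun t => (f t : ℂ)) x = ((∫ t, k (x - t) * f t : ℝ) : ℂ) := by
  simp only [kernelConv, ← Complex.ofReal_mul]
  exact integral_ofReal

-- For t in the bounded support, |z - t| is comparable to 1 + |z| once Im z ≥ y. The resulting decay
-- 1/|z| makes F^p decay like |z|^(-p) with p > 1, as the contour argument requires.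
open Complex in
lemma norm_halfPlaneExtension_le {f : ℝ → ℝ} {R : ℝ} (hR : 0 ≤ R)
    (hfR : ∀ t, R < |t| → f t = 0) (hf : Integrable f) {y : ℝ} (hy : 0 < y) :
    ∀ z : ℂ, y ≤ z.im → ‖halfPlaneExtension f z‖ ≤
      (Real.pi⁻¹ * (1 + (R + 1) / y) * ∫ t, ‖f t‖) * (1 + ‖z‖)⁻¹ := by
  intro z hz
  have hzp : 0 < 1 + ‖z‖ := by positivity
  calc ‖halfPlaneExtension f z‖
      ≤ ∫ t, (Real.pi⁻¹ * (1 + (R + 1) / y) * (1 + ‖z‖)⁻¹) * ‖f t‖ := by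
        refine norm_integral_le_of_norm_le (hf.norm.const_mul _) (Eventually.of_forall fun t => ?_)
        rw [norm_mul, norm_halfPlaneExtension_kernel, norm_real]
        rcases lt_or_ge R |t| with h | h
        · simp [hfR t h]
        · have h1 : y ≤ ‖z - t‖ := hz.trans (im_le_norm_sub_ofReal z t)
          have h2 : ‖z - t‖⁻¹ ≤ (1 + (R + 1) / y) * (1 + ‖z‖)⁻¹ := by
            rw [← div_eq_mul_inv, inv_eq_one_div, div_le_div_iff₀ (hy.trans_le h1) hzp]
            have h3 : ‖z‖ ≤ ‖z - t‖ + R := by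
              have := norm_add_le (z - t) (t : ℂ)
              rw [sub_add_cancel, norm_real] at this
              exact this.trans (by gcongr; exact h)
            have h4 : R + 1 ≤ (R + 1) / y * ‖z - t‖ := by
              rw [div_mul_eq_mul_div, le_div_iff₀ hy]; gcongr
            linarith
          calc _ ≤ Real.pi⁻¹ * ((1 + (R + 1) / y) * (1 + ‖z‖)⁻¹) * ‖f t‖ := by gcongr
            _ = _ := by ring
    _ = _ := by rw [integral_const_mul]; ring

open Complex in
/-- The elementary inequality behind the theorem of M. Riesz for `1 < p ≤ 2`. -/
lemma exists_norm_rpow_le {p : ℝ} (hp : 1 < p) (hp2 : p ≤ 2) :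
    ∃ A B : ℝ, 0 ≤ A ∧ 0 ≤ B ∧ ∀ w : ℂ, 0 < w.re →
      ‖w‖ ^ p ≤ A * w.re ^ p - B * (w ^ (p : ℂ)).re := by
  have hpi := Real.pi_pos
  have hp0 : 0 < p := by linarith
  -- The angle satisfies θ < π/2 < pθ ≤ 3π/4, so cos θ > 0 while cos(pθ) < 0.
  set θ : ℝ := Real.pi * (p + 1) / (4 * p) with hθ
  have hpθ : p * θ = Real.pi * (p + 1) / 4 := by rw [hθ]; field_simp
  have hθ0 : 0 < θ := by positivity
  have hθ1 : θ < Real.pi / 2 := by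
    rw [hθ, div_lt_div_iff₀ (by positivity) two_pos]; nlinarith
  have hc0 : Real.cos (p * θ) < 0 := by
    apply Real.cos_neg_of_pi_div_two_lt_of_lt <;> rw [hpθ] <;> nlinarith
  have hc1 : 0 < Real.cos θ := Real.cos_pos_of_mem_Ioo ⟨by linarith, hθ1⟩
  set B : ℝ := (-Real.cos (p * θ))⁻¹ with hB
  have hB0 : 0 < B := inv_pos.2 (by linarith)
  refine ⟨(1 + B) / Real.cos θ ^ p, B, by positivity, hB0.le, fun w hw => ?_⟩
  have harg : |arg w| < Real.pi / 2 := abs_arg_lt_pi_div_two_iff.2 (Or.inl hw)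
  have hcos : 0 < Real.cos (arg w) := Real.cos_pos_of_mem_Ioo (abs_lt.1 harg)
  have hre : w.re = ‖w‖ * Real.cos (arg w) := (norm_mul_cos_arg w).symm
  rw [cpow_ofReal_re, hre, Real.mul_rpow (norm_nonneg _) hcos.le]
  suffices h : 1 ≤ (1 + B) / Real.cos θ ^ p * Real.cos (arg w) ^ p -
      B * Real.cos (arg w * p) by
    have h' := mul_le_mul_of_nonneg_left h (Real.rpow_nonneg (norm_nonneg w) p)
    linarith
  have hcp : 0 ≤ Real.cos (arg w) ^ p := by positivity
  -- Near the imaginary axis the term -B Re(w^p) alone dominates |w|^p; there p |arg w| ≤ π because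
  -- p ≤ 2, so the cosine is still decreasing. In the remaining sector Re w is comparable to |w|,
  -- and A also absorbs the term in B.
  rcases le_or_gt θ |arg w| with h | h
  · have h1 : Real.cos (arg w * p) ≤ Real.cos (p * θ) := by
      rw [← Real.cos_abs (arg w * p), abs_mul, abs_of_pos hp0, mul_comm]
      apply Real.cos_le_cos_of_nonneg_of_le_pi (by positivity)
      · nlinarith
      · gcongr
    have h2 : B * Real.cos (arg w * p) ≤ -1 := by
      calc B * Real.cos (arg w * p) ≤ B * Real.cos (p * θ) := by gcongr
        _ = -1 := by rw [hB, inv_neg, neg_mul, inv_mul_cancel₀ hc0.ne]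
    have h3 : 0 ≤ (1 + B) / Real.cos θ ^ p * Real.cos (arg w) ^ p := by positivity
    linarith
  · have h1 : Real.cos θ ≤ Real.cos (arg w) := by
      rw [← Real.cos_abs (arg w)]
      exact Real.cos_le_cos_of_nonneg_of_le_pi (abs_nonneg _) (by linarith) h.le
    have h2 : 1 + B ≤ (1 + B) / Real.cos θ ^ p * Real.cos (arg w) ^ p := by
      rw [div_mul_eq_mul_div, le_div_iff₀ (by positivity)]
      gcongr
    have h3 : B * Real.cos (arg w * p) ≤ B := mul_le_of_le_one_right hB0.le (Real.cos_le_one _)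
    linarith

open Complex in
lemma continuous_halfPlaneExtension_line {f : ℝ → ℝ} (hf : Integrable f) {y : ℝ} (hy : 0 < y) :
    Continuous fun x : ℝ => halfPlaneExtension f (x + y * I) := by
  rw [continuous_iff_continuousAt]
  intro x
  have hc : Continuous fun x : ℝ => (x + y * I : ℂ) := by fun_prop
  have hd := differentiableAt_halfPlaneExtension hf (z₀ := x + y * I) (by simpa using hy)
  exact ContinuousAt.comp (f := fun x : ℝ => (x + y * I : ℂ)) hd.continuousAt hc.continuousAt

lemma integrable_of_memLp_of_bounded_support {E : Type*} [NormedAddCommGroup E] {p : ℝ}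
    (hp : 1 ≤ p) {f : ℝ → E}
    (hf : MemLp f (ENNReal.ofReal p)) {R : ℝ} (hfR : ∀ t, R < |t| → f t = 0) : Integrable f := by
  rw [← memLp_one_iff_integrable]
  refine hf.mono_exponent_of_measure_support_ne_top (s := Icc (-R) R) (fun t ht => hfR t ?_)
    (by simp) (by simpa using ENNReal.ofReal_le_ofReal hp)
  rwa [mem_Icc, ← abs_le, not_le] at ht

open Complex in
/-- M. Riesz's inequality for nonnegative functions of bounded support and `1 < p ≤ 2`. -/
lemma exists_eLpNorm_conj_le_of_nonneg {p : ℝ} (hp : 1 < p) (hp2 : p ≤ 2) :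
    ∃ C : ℝ≥0, ∀ (f : ℝ → ℝ) (R : ℝ), (∀ t, 0 ≤ f t) → MemLp f (ENNReal.ofReal p) →
      (∀ t, R < |t| → f t = 0) → ∀ y, 0 < y →
      eLpNorm (kernelConv (conjPoissonLine y) fun t => (f t : ℂ)) (ENNReal.ofReal p) ≤
        C * eLpNorm f (ENNReal.ofReal p) := by
  obtain ⟨A, B, hA, hB, hAB⟩ := exists_norm_rpow_le hp hp2
  have hp0 : 0 < p := by linarith
  refine ⟨Real.toNNReal (A ^ p⁻¹), fun f R hf0 hfp hfR y hy => ?_⟩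
  wlog hR : 0 ≤ R generalizing R
  · exact this 0 (fun t ht => hfR t ((not_le.1 hR).trans ht)) le_rfl
  -- For f not almost everywhere zero, Re F is strictly positive, so F avoids the branch cut of w^p
  -- and F^p is holomorphic.
  by_cases hfz : f =ᵐ[volume] 0
  · have : (fun t => (f t : ℂ)) =ᵐ[volume] 0 := hfz.mono fun t ht => by simp [ht]
    rw [kernelConv_congr _ this]
    have h0 : kernelConv (conjPoissonLine y) 0 = 0 := by funext x; simp [kernelConv]
    simp [h0]
  have hf1 : Integrable f := integrable_of_memLp_of_bounded_support hp.le hfp hfR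
  set F := halfPlaneExtension f with hF
  have hpos : ∀ z : ℂ, y ≤ z.im → 0 < (F z).re := by
    intro z hz
    have hz0 := hy.trans_le hz
    rw [← re_add_im z, (halfPlaneExtension_re_im hf1 hz0 z.re).1]
    have hposk : ∀ u, 0 < poissonLine z.im u := fun u => by unfold poissonLine; positivity
    rw [integral_pos_iff_support_of_nonneg (fun t => mul_nonneg (hposk _).le (hf0 t))]
    · have : (Function.support fun t => poissonLine z.im (z.re - t) * f t) =
          Function.support f := by
        ext t; simp [(hposk (z.re - t)).ne']
      rw [this, pos_iff_ne_zero]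
      exact fun h => hfz ((ae_iff.2 h))
    · refine hf1.bdd_mul (c := 1 + z.im⁻¹) ((measurable_poissonLine _).comp
        (measurable_id.const_sub _)).aestronglyMeasurable (Eventually.of_forall fun t => ?_)
      refine (abs_poissonLine_le hz0 _).trans (mul_le_of_le_one_right (by positivity) ?_)
      exact inv_le_one_of_one_le₀ (by linarith [abs_nonneg (z.re - t)])
  have hdecay := norm_halfPlaneExtension_le hR hfR hf1 hy
  set M := Real.pi⁻¹ * (1 + (R + 1) / y) * ∫ t, ‖f t‖ with hM
  have hM0 : 0 ≤ M := by positivity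
  have hzero : ∫ x : ℝ, (fun z => F z ^ (p : ℂ)) (x + y * I) = 0 := by
    refine integral_horizontal_eq_zero (G := fun z => F z ^ (p : ℂ)) (C := M ^ p) (a := p)
      (R₀ := 1) (fun z hz => ?_) hp one_pos fun z hz hz1 => ?_
    · exact (differentiableAt_halfPlaneExtension hf1 (hy.trans_le hz)).cpow_const
        (Or.inl (hpos z hz))
    · rw [norm_cpow_real, Real.rpow_neg (norm_nonneg _), ← Real.inv_rpow (norm_nonneg _),
        ← Real.mul_rpow hM0 (by positivity)]
      refine Real.rpow_le_rpow (norm_nonneg _) ((hdecay z hz).trans ?_) hp0.le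
      gcongr
      linarith
  have hcont := continuous_halfPlaneExtension_line hf1 hy
  have hFp : MemLp (fun x : ℝ => F (x + y * I)) (ENNReal.ofReal p) := by
    rw [← memLp_norm_iff hcont.aestronglyMeasurable]
    refine memLp_of_le_inv_one_add_abs (c := M) hcont.norm.measurable (fun x => ?_) hp
    rw [abs_of_nonneg (norm_nonneg _)]
    refine (hdecay _ (by simp)).trans ?_
    gcongr
    simpa using abs_re_le_norm (x + y * I : ℂ)
  have hne : ENNReal.ofReal p ≠ 0 := by simpa using hp0
  have hintF : Integrable fun x : ℝ => ‖F (x + y * I)‖ ^ p := by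
    simpa [ENNReal.toReal_ofReal hp0.le] using hFp.integrable_norm_rpow hne ENNReal.ofReal_ne_top
  have hu : ∀ x : ℝ, kernelConv (poissonLine y) (fun t => (f t : ℂ)) x =
      ((F (x + y * I)).re : ℂ) := fun x => by
    rw [kernelConv_ofReal, hF, (halfPlaneExtension_re_im hf1 hy x).1]
  have hv : ∀ x : ℝ, kernelConv (conjPoissonLine y) (fun t => (f t : ℂ)) x =
      ((F (x + y * I)).im : ℂ) := fun x => by
    rw [kernelConv_ofReal, hF, (halfPlaneExtension_re_im hf1 hy x).2]
  have hintre : Integrable fun x : ℝ => (F (x + y * I)).re ^ p := by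
    refine hintF.mono' ?_ (Eventually.of_forall fun x => ?_)
    · exact ((Complex.continuous_re.comp hcont).measurable.pow_const p).aestronglyMeasurable
    · rw [Real.norm_of_nonneg (Real.rpow_nonneg (hpos _ (by simp)).le _)]
      exact Real.rpow_le_rpow (hpos _ (by simp)).le (re_le_norm _) hp0.le
  have hintpow : Integrable fun x : ℝ => F (x + y * I) ^ (p : ℂ) := by
    refine hintF.mono' ?_ (Eventually.of_forall fun x => by rw [norm_cpow_real])
    refine Continuous.aestronglyMeasurable (continuous_iff_continuousAt.2 fun x => ?_)
    exact ContinuousAt.cpow hcont.continuousAt continuousAt_const (Or.inl (hpos _ (by simp)))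
  have hBint : Integrable fun x : ℝ => B * (F (x + y * I) ^ (p : ℂ)).re := hintpow.re.const_mul B
  -- The elementary inequality is integrated along the line, where the term in F^p contributes
  -- nothing by `hzero`.
  have hmain : ∫ x : ℝ, ‖F (x + y * I)‖ ^ p ≤ A * ∫ x : ℝ, (F (x + y * I)).re ^ p := by
    have h1 : ∫ x : ℝ, (F (x + y * I) ^ (p : ℂ)).re = 0 := by
      have h2 : ∫ x : ℝ, (F (x + y * I) ^ (p : ℂ)).re =
        (∫ x : ℝ, F (x + y * I) ^ (p : ℂ)).re := integral_re hintpow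
      rw [h2, hzero, zero_re]
    calc ∫ x : ℝ, ‖F (x + y * I)‖ ^ p
        ≤ ∫ x : ℝ, (A * (F (x + y * I)).re ^ p - B * (F (x + y * I) ^ (p : ℂ)).re) := by
          refine integral_mono hintF ((hintre.const_mul A).sub hBint)
            fun x => hAB _ (hpos _ (by simp))
      _ = _ := by
          rw [integral_sub (hintre.const_mul A) hBint, integral_const_mul,
            integral_const_mul, h1, mul_zero, sub_zero]
  rw [← ENNReal.rpow_le_rpow_iff hp0, ENNReal.mul_rpow_of_nonneg _ _ hp0.le,
    eLpNorm_ofReal_rpow hp0]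
  have hAC : ((Real.toNNReal (A ^ p⁻¹) : ℝ≥0) : ℝ≥0∞) ^ p = ENNReal.ofReal A := by
    change ENNReal.ofReal (A ^ p⁻¹) ^ p = _
    rw [ENNReal.ofReal_rpow_of_nonneg (by positivity) hp0.le, Real.rpow_inv_rpow hA hp0.ne']
  have hfP := eLpNorm_kernelConv_poissonLine_le hp hy (f := fun t => (f t : ℂ)) hfp.ofReal.1
  have hfn : eLpNorm (fun t => (f t : ℂ)) (ENNReal.ofReal p) volume =
      eLpNorm f (ENNReal.ofReal p) volume :=
    eLpNorm_congr_norm_ae (Eventually.of_forall fun t => by simp)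
  rw [hfn, ← ENNReal.rpow_le_rpow_iff hp0, eLpNorm_ofReal_rpow hp0] at hfP
  have henorm : ∀ w : ℂ, ‖w‖ₑ ^ p = ENNReal.ofReal (‖w‖ ^ p) := fun w => by
    rw [← ofReal_norm, ENNReal.ofReal_rpow_of_nonneg (norm_nonneg _) hp0.le]
  calc ∫⁻ x, ‖kernelConv (conjPoissonLine y) (fun t => (f t : ℂ)) x‖ₑ ^ p
      ≤ ∫⁻ x : ℝ, ENNReal.ofReal (‖F (x + y * I)‖ ^ p) := by
        refine lintegral_mono fun x => ?_
        rw [henorm, hv, norm_real]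
        exact ENNReal.ofReal_le_ofReal
          (Real.rpow_le_rpow (norm_nonneg _) (abs_im_le_norm _) hp0.le)
    _ = ENNReal.ofReal (∫ x : ℝ, ‖F (x + y * I)‖ ^ p) :=
        (ofReal_integral_eq_lintegral_ofReal hintF
          (Eventually.of_forall fun x => by positivity)).symm
    _ ≤ ENNReal.ofReal (A * ∫ x : ℝ, (F (x + y * I)).re ^ p) := ENNReal.ofReal_le_ofReal hmain
    _ = ENNReal.ofReal A * ∫⁻ x, ‖kernelConv (poissonLine y) (fun t => (f t : ℂ)) x‖ₑ ^ p := by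
        rw [ENNReal.ofReal_mul hA, ofReal_integral_eq_lintegral_ofReal hintre
          (Eventually.of_forall fun x => Real.rpow_nonneg (hpos _ (by simp)).le _)]
        congr 1
        refine lintegral_congr fun x => ?_
        rw [henorm, hu, norm_real, Real.norm_of_nonneg (hpos _ (by simp)).le]
    _ ≤ _ := by rw [hAC]; gcongr

/-! ### M. Riesz's theorem for all 1 < p < ∞ -/

/-- The conjugate Poisson means of `L^p` functions are bounded on `L^p` by `C`, uniformly in the
height. -/
def ConjPoissonBoundedBy (p : ℝ) (C : ℝ≥0) : Prop :=
  ∀ f : ℝ → ℂ, MemLp f (ENNReal.ofReal p) → ∀ y, 0 < y →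
    eLpNorm (kernelConv (conjPoissonLine y) f) (ENNReal.ofReal p) ≤
      C * eLpNorm f (ENNReal.ofReal p)

lemma tendsto_indicator_Icc_nat {E : Type*} [Zero E] [TopologicalSpace E] (f : ℝ → E) (x : ℝ) :
    Tendsto (fun n : ℕ => (Icc (-(n : ℝ)) n).indicator f x) atTop (𝓝 (f x)) := by
  refine tendsto_const_nhds.congr' ?_
  filter_upwards [eventually_ge_atTop ⌈|x|⌉₊] with n hn
  rw [indicator_of_mem]
  exact abs_le.1 ((Nat.le_ceil _).trans (by exact_mod_cast hn))

/-- Truncations of f to [-n, n] have conjugate means converging pointwise by dominated convergence;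
Fatou's lemma carries the bound to the limit. -/
lemma conjPoissonBoundedBy_of_bounded_support {p : ℝ} (hp : 1 < p) {C : ℝ≥0}
    (h : ∀ (f : ℝ → ℂ) (R : ℝ), MemLp f (ENNReal.ofReal p) → (∀ t, R < |t| → f t = 0) →
      ∀ y, 0 < y → eLpNorm (kernelConv (conjPoissonLine y) f) (ENNReal.ofReal p) ≤
        C * eLpNorm f (ENNReal.ofReal p)) :
    ConjPoissonBoundedBy p C := by
  intro f hf y hy
  have hpq := Real.HolderConjugate.conjExponent hp
  have := hpq.ennrealOfReal
  have hmem : ∀ n : ℕ, MemLp ((Icc (-(n : ℝ)) n).indicator f) (ENNReal.ofReal p) :=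
    fun n => hf.indicator measurableSet_Icc
  refine (Lp.eLpNorm_lim_le_liminf_eLpNorm
    (f := fun n : ℕ => kernelConv (conjPoissonLine y) ((Icc (-(n : ℝ)) n).indicator f))
    (fun n => (stronglyMeasurable_kernelConv (measurable_conjPoissonLine y)
      (hmem n).1).aestronglyMeasurable) _
    (Eventually.of_forall fun x => ?_)).trans ?_
  · refine tendsto_integral_of_dominated_convergence
      (fun t => ‖((conjPoissonLine y (x - t) : ℝ) : ℂ) * f t‖)
      (fun n => (integrable_kernel_mul (memLp_conjPoissonLine hy hpq.symm.lt) (hmem n) x).1)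
      (integrable_kernel_mul (memLp_conjPoissonLine hy hpq.symm.lt) hf x).norm
      (fun n => Eventually.of_forall fun t => ?_)
      (Eventually.of_forall fun t => (tendsto_indicator_Icc_nat f t).const_mul _)
    rw [norm_mul, norm_mul]
    gcongr
    exact norm_indicator_le_norm_self _ _
  · refine liminf_le_of_le ⟨0, by simp⟩ fun b hb => ?_
    obtain ⟨n, hn⟩ := hb.exists
    refine hn.trans ((h _ n (hmem n) (fun t ht => ?_) y hy).trans ?_)
    · have hz : t ∉ Icc (-(n : ℝ)) n := fun h' => ht.not_ge (abs_le.2 h')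
      exact indicator_of_notMem hz f
    · gcongr
      exact eLpNorm_indicator_le _

/-- The positive and negative parts of Re f and Im f are nonnegative, dominated by |f|, and vanish
where f does. Four applications of the nonnegative case give the constant 4C. -/
lemma exists_conjPoissonBoundedBy_of_le_two {p : ℝ} (hp : 1 < p) (hp2 : p ≤ 2) :
    ∃ C, ConjPoissonBoundedBy p C := by
  obtain ⟨C, hC⟩ := exists_eLpNorm_conj_le_of_nonneg hp hp2
  refine ⟨4 * C, conjPoissonBoundedBy_of_bounded_support hp fun f R hf hfR y hy => ?_⟩
  have hpq := Real.HolderConjugate.conjExponent hp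
  have := hpq.ennrealOfReal
  have hp1 : 1 ≤ ENNReal.ofReal p := by simpa using ENNReal.ofReal_le_ofReal hp.le
  have hQ := memLp_conjPoissonLine hy hpq.symm.lt
  have hpart : ∀ φ : ℂ → ℝ, Continuous φ → (∀ w, 0 ≤ φ w) → (∀ w, φ w ≤ ‖w‖) →
      MemLp (fun t => (φ (f t) : ℂ)) (ENNReal.ofReal p) ∧
      AEStronglyMeasurable (kernelConv (conjPoissonLine y) fun t => (φ (f t) : ℂ)) ∧
      eLpNorm (kernelConv (conjPoissonLine y) fun t => (φ (f t) : ℂ)) (ENNReal.ofReal p) ≤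
        C * eLpNorm f (ENNReal.ofReal p) := by
    intro φ hφ hφ0 hφn
    have hle : ∀ t, ‖φ (f t)‖ ≤ ‖f t‖ := fun t => by
      rw [Real.norm_of_nonneg (hφ0 _)]; exact hφn _
    have hm : MemLp (fun t => φ (f t)) (ENNReal.ofReal p) :=
      hf.of_le (hφ.comp_aestronglyMeasurable hf.1) (Eventually.of_forall hle)
    refine ⟨hm.ofReal, (stronglyMeasurable_kernelConv (measurable_conjPoissonLine y)
      hm.ofReal.1).aestronglyMeasurable, (hC _ R (fun t => hφ0 _) hm (fun t ht => ?_) y hy).trans ?_⟩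
    · have := hle t
      rw [hfR t ht, norm_zero] at this
      rw [hfR t ht]
      exact norm_le_zero_iff.1 this
    · gcongr
      exact eLpNorm_mono hle
  obtain ⟨ha, ha', ha2⟩ := hpart (fun w => max w.re 0) (by fun_prop) (fun w => le_max_right _ _)
    (fun w => max_le (Complex.re_le_norm w) (norm_nonneg w))
  obtain ⟨hb, hb', hb2⟩ := hpart (fun w => max (-w.re) 0) (by fun_prop) (fun w => le_max_right _ _)
    (fun w => max_le ((neg_le_abs _).trans (Complex.abs_re_le_norm w)) (norm_nonneg w))
  obtain ⟨hc, hc', hc2⟩ := hpart (fun w => max w.im 0) (by fun_prop) (fun w => le_max_right _ _)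
    (fun w => max_le (Complex.im_le_norm w) (norm_nonneg w))
  obtain ⟨hd, hd', hd2⟩ := hpart (fun w => max (-w.im) 0) (by fun_prop) (fun w => le_max_right _ _)
    (fun w => max_le ((neg_le_abs _).trans (Complex.abs_im_le_norm w)) (norm_nonneg w))
  set a : ℝ → ℂ := fun t => ((max (f t).re 0 : ℝ) : ℂ)
  set b : ℝ → ℂ := fun t => ((max (-(f t).re) 0 : ℝ) : ℂ)
  set c : ℝ → ℂ := fun t => ((max (f t).im 0 : ℝ) : ℂ)
  set d : ℝ → ℂ := fun t => ((max (-(f t).im) 0 : ℝ) : ℂ)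
  have hmax : ∀ r : ℝ, max r 0 - max (-r) 0 = r := fun r => by
    rcases le_total 0 r with h | h
    · rw [max_eq_left h, max_eq_right (by linarith), sub_zero]
    · rw [max_eq_right h, max_eq_left (by linarith)]; ring
  have hf_eq : f = (a - b) + fun t => Complex.I * (c - d) t := by
    funext t
    simp only [Pi.add_apply, Pi.sub_apply, a, b, c, d, ← Complex.ofReal_sub, hmax]
    rw [mul_comm, Complex.re_add_im]
  have hk_eq : kernelConv (conjPoissonLine y) f =
      (kernelConv (conjPoissonLine y) a - kernelConv (conjPoissonLine y) b) +
      Complex.I • (kernelConv (conjPoissonLine y) c - kernelConv (conjPoissonLine y) d) := by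
    funext x
    rw [hf_eq, kernelConv_add hQ (ha.sub hb) ((hc.sub hd).const_mul _), kernelConv_sub hQ ha hb,
      kernelConv_smul, kernelConv_sub hQ hc hd]
    rfl
  rw [hk_eq]
  refine (eLpNorm_add_le (ha'.sub hb') ((hc'.sub hd').const_smul _) hp1).trans ?_
  rw [eLpNorm_const_smul]
  have hI : ‖Complex.I‖ₑ = 1 := by simp [← ofReal_norm]
  rw [hI, one_mul]
  refine (add_le_add (eLpNorm_sub_le ha' hb' hp1) (eLpNorm_sub_le hc' hd' hp1)).trans ?_
  refine (add_le_add (add_le_add ha2 hb2) (add_le_add hc2 hd2)).trans_eq ?_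
  push_cast
  ring

lemma abs_conjPoissonLine_le_const {y : ℝ} (hy : 0 < y) (u : ℝ) :
    |conjPoissonLine y u| ≤ 1 + y⁻¹ :=
  (abs_conjPoissonLine_le hy u).trans (mul_le_of_le_one_right (by positivity)
    (inv_le_one_of_one_le₀ (by linarith [abs_nonneg u])))

/-- The conjugate Poisson means are antisymmetric. -/
lemma integral_kernelConv_conjPoissonLine_mul {f g : ℝ → ℂ} (hf : Integrable f)
    (hg : Integrable g) {y : ℝ} (hy : 0 < y) :
    ∫ x, kernelConv (conjPoissonLine y) f x * g x =
      -∫ t, f t * kernelConv (conjPoissonLine y) g t := by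
  have hmeas : Measurable fun z : ℝ × ℝ => ((conjPoissonLine y (z.1 - z.2) : ℝ) : ℂ) :=
    Complex.measurable_ofReal.comp
      ((measurable_conjPoissonLine y).comp (measurable_fst.sub measurable_snd))
  have hint : Integrable (Function.uncurry fun x t : ℝ =>
      ((conjPoissonLine y (x - t) : ℝ) : ℂ) * (g x * f t)) (volume.prod volume) := by
    refine (hg.mul_prod hf).bdd_mul (c := 1 + y⁻¹) hmeas.aestronglyMeasurable
      (Eventually.of_forall fun z => ?_)
    rw [Complex.norm_real]
    exact abs_conjPoissonLine_le_const hy _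
  have h1 : ∫ x, kernelConv (conjPoissonLine y) f x * g x =
      ∫ x, ∫ t, ((conjPoissonLine y (x - t) : ℝ) : ℂ) * (g x * f t) := by
    refine integral_congr_ae (Eventually.of_forall fun x => ?_)
    simp only [kernelConv, ← integral_mul_const]
    congr 1; funext t; ring
  rw [h1, integral_integral_swap hint, ← integral_neg]
  refine integral_congr_ae (Eventually.of_forall fun t => ?_)
  simp only [kernelConv, ← integral_const_mul, ← integral_neg]
  congr 1; funext x
  rw [← neg_sub t x, conjPoissonLine_neg]; push_cast; ring

/-- Since J = J^(1/p) J^(1/q), the factor J^(1/q) cancels. The cancellation needs J finite, which is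
why the duality argument truncates its test function. -/
lemma ENNReal.rpow_inv_le_of_le_mul_rpow_inv {p q : ℝ} (hpq : p.HolderConjugate q) {J a : ℝ≥0∞}
    (hJ : J ≠ ∞) (h : J ≤ a * J ^ q⁻¹) : J ^ p⁻¹ ≤ a := by
  rcases eq_or_ne J 0 with rfl | h0
  · rw [ENNReal.zero_rpow_of_pos (inv_pos.2 hpq.pos)]; exact zero_le
  have h1 : J = J ^ p⁻¹ * J ^ q⁻¹ := by
    rw [← ENNReal.rpow_add _ _ h0 hJ, hpq.inv_add_inv_eq_one, ENNReal.rpow_one]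
  have h2 : J ^ q⁻¹ ≠ 0 := (ENNReal.rpow_pos (pos_iff_ne_zero.2 h0) hJ).ne'
  have h3 : J ^ q⁻¹ ≠ ∞ := ENNReal.rpow_ne_top_of_nonneg (inv_nonneg.2 hpq.symm.nonneg) hJ
  exact (ENNReal.mul_le_mul_iff_left h2 h3).1 (h1.symm.trans_le h)

/-- Duality: with h = Q_y * f, the test function g = |h|^(p-2) h̄ on [-n, n] satisfies ∫ h g = J and
‖g‖_q = J^(1/q), where J is the integral of |h|^p over [-n, n]. Antisymmetry moves the conjugate
kernel onto g, where the L^q bound applies, and Fatou removes the truncation. -/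
lemma conjPoissonBoundedBy_of_holderConjugate {p q : ℝ} (hpq : p.HolderConjugate q) (hp2 : 2 < p)
    {C : ℝ≥0} (hC : ConjPoissonBoundedBy q C) : ConjPoissonBoundedBy p C := by
  refine conjPoissonBoundedBy_of_bounded_support hpq.lt fun f R hf hfR y hy => ?_
  have := hpq.ennrealOfReal
  have hp0 := hpq.pos
  have hq0 := hpq.symm.pos
  have hf1 : Integrable f := integrable_of_memLp_of_bounded_support hpq.lt.le hf hfR
  set h := kernelConv (conjPoissonLine y) f with hh
  have hm : StronglyMeasurable h := stronglyMeasurable_kernelConv (measurable_conjPoissonLine y) hf.1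
  -- A bounded kernel against an integrable f. Boundedness of h puts the truncated test function in
  -- every L^r.
  obtain ⟨K, hK⟩ : ∃ K : ℝ, ∀ x, ‖h x‖ ≤ K :=
    ⟨∫ t, (1 + y⁻¹) * ‖f t‖, fun x => norm_integral_le_of_norm_le (hf1.norm.const_mul _)
      (Eventually.of_forall fun t => by
        rw [norm_mul, Complex.norm_real]
        gcongr
        exact abs_conjPoissonLine_le_const hy _)⟩
  have hK0 : 0 ≤ K := (norm_nonneg _).trans (hK 0)
  suffices hN : ∀ n : ℕ, eLpNorm ((Icc (-(n : ℝ)) n).indicator h) (ENNReal.ofReal p) ≤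
      C * eLpNorm f (ENNReal.ofReal p) by
    refine (Lp.eLpNorm_lim_le_liminf_eLpNorm
      (fun n : ℕ => (hm.indicator measurableSet_Icc).aestronglyMeasurable) h
      (Eventually.of_forall fun x => tendsto_indicator_Icc_nat h x)).trans ?_
    refine liminf_le_of_le ⟨0, by simp⟩ fun b hb => ?_
    obtain ⟨n, hn⟩ := hb.exists
    exact hn.trans (hN n)
  intro n
  set s := Icc (-(n : ℝ)) n
  set g : ℝ → ℂ := s.indicator fun x => ((‖h x‖ ^ (p - 2) : ℝ) : ℂ) * (starRingEnd ℂ) (h x) with hg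
  have hgn : ∀ x, ‖g x‖ = s.indicator (fun x => ‖h x‖ ^ (p - 1)) x := fun x => by
    by_cases hx : x ∈ s
    · rw [hg, indicator_of_mem hx, indicator_of_mem hx, norm_mul, Complex.norm_real,
        RCLike.norm_conj, Real.norm_of_nonneg (by positivity)]
      conv_lhs => rw [← Real.rpow_one ‖h x‖, ← Real.rpow_mul (norm_nonneg _)]
      rw [one_mul, ← Real.rpow_add_of_nonneg (norm_nonneg _) (by linarith) zero_le_one]
      congr 1; ring
    · rw [hg, indicator_of_notMem hx, indicator_of_notMem hx, norm_zero]
  have hgm : AEStronglyMeasurable g := by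
    refine (Measurable.indicator ?_ measurableSet_Icc).aestronglyMeasurable
    have := hm.measurable
    have h2 : Measurable fun x => ((‖h x‖ ^ (p - 2) : ℝ) : ℂ) := by fun_prop
    exact h2.mul (Complex.continuous_conj.measurable.comp this)
  have hgK : ∀ x, ‖g x‖ ≤ K ^ (p - 1) := fun x => by
    rw [hgn]
    exact indicator_le' (fun x _ => Real.rpow_le_rpow (norm_nonneg _) (hK x) (by linarith))
      (fun x _ => by positivity) x
  have hgs : g = s.indicator g := by rw [hg, indicator_indicator, inter_self]
  have hgp : ∀ r : ℝ≥0∞, MemLp g r := fun r => by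
    rw [hgs, memLp_indicator_iff_restrict measurableSet_Icc]
    exact MemLp.of_bound hgm.restrict _ (Eventually.of_forall hgK)
  have hg1 : Integrable g := memLp_one_iff_integrable.1 (hgp 1)
  set J : ℝ≥0∞ := ∫⁻ x in s, ‖h x‖ₑ ^ p with hJ
  have hJi : ∫⁻ x, ‖s.indicator h x‖ₑ ^ p = J := by
    have hs : MeasurableSet s := measurableSet_Icc
    rw [hJ, ← lintegral_indicator hs]
    refine lintegral_congr fun x => ?_
    by_cases hx : x ∈ s <;> simp [hx, hp0]
  have hJg : ∫⁻ x, ‖g x‖ₑ ^ q = J := by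
    rw [← hJi]
    refine lintegral_congr fun x => ?_
    rw [← ofReal_norm, hgn]
    by_cases hx : x ∈ s
    · rw [indicator_of_mem hx, indicator_of_mem hx, ← ENNReal.ofReal_rpow_of_nonneg (norm_nonneg _)
        (by linarith), ofReal_norm, ← ENNReal.rpow_mul, hpq.sub_one_mul_conj]
    · simp [hx, hp0, hq0]
  have hJh : J = ∫⁻ x, ‖h x * g x‖ₑ := by
    rw [← hJi]
    refine lintegral_congr fun x => ?_
    rw [← ofReal_norm (h x * g x), norm_mul, hgn]
    by_cases hx : x ∈ s
    · rw [indicator_of_mem hx, indicator_of_mem hx, ← ofReal_norm,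
        ENNReal.ofReal_rpow_of_nonneg (norm_nonneg _) hp0.le]
      conv_rhs => rw [← Real.rpow_one ‖h x‖, ← Real.rpow_mul (norm_nonneg _)]
      rw [one_mul, ← Real.rpow_add_of_nonneg (norm_nonneg _) zero_le_one (by linarith)]
      congr 2; ring
    · simp [hx, hp0]
  have hJtop : J ≠ ∞ := by
    rw [← hJg, ← eLpNorm_ofReal_rpow hq0]
    exact ENNReal.rpow_ne_top_of_nonneg hq0.le (hgp _).eLpNorm_ne_top
  have hJint : J = ‖∫ x, h x * g x‖ₑ := by
    have hre : ∀ x, h x * g x = ((‖h x * g x‖ : ℝ) : ℂ) := fun x => by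
      by_cases hx : x ∈ s
      · rw [hg, indicator_of_mem hx]
        have : h x * (((‖h x‖ ^ (p - 2) : ℝ) : ℂ) * (starRingEnd ℂ) (h x)) =
            ((‖h x‖ ^ (p - 2) * ‖h x‖ ^ 2 : ℝ) : ℂ) := by
          rw [mul_left_comm, Complex.mul_conj, Complex.normSq_eq_norm_sq]; push_cast; ring
        rw [this, Complex.norm_real, Real.norm_of_nonneg (by positivity)]
      · rw [hg, indicator_of_notMem hx]; simp
    have hi : Integrable fun x => h x * g x :=
      hg1.bdd_mul hm.aestronglyMeasurable (Eventually.of_forall hK)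
    have h2 : ∫ x, h x * g x = ((∫ x, ‖h x * g x‖ : ℝ) : ℂ) := by
      conv_lhs => enter [2, x]; rw [hre x]
      exact integral_ofReal
    rw [h2, ← ofReal_norm, Complex.norm_real,
      Real.norm_of_nonneg (integral_nonneg fun x => norm_nonneg _),
      ofReal_integral_norm_eq_lintegral_enorm hi, hJh]
  have hle : J ≤ (C * eLpNorm f (ENNReal.ofReal p)) * J ^ q⁻¹ := by
    have hgJ : eLpNorm g (ENNReal.ofReal q) volume = J ^ q⁻¹ := by
      rw [← hJg, ← eLpNorm_ofReal_rpow hq0, ENNReal.rpow_rpow_inv hq0.ne']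
    have hkg := hC g (hgp _) y hy
    rw [hgJ] at hkg
    refine hJint.trans_le ?_
    rw [integral_kernelConv_conjPoissonLine_mul hf1 hg1 hy, enorm_neg]
    have hhold := eLpNorm_smul_le_mul_eLpNorm (μ := volume) (p := ENNReal.ofReal p)
      (q := ENNReal.ofReal q) (r := 1) (stronglyMeasurable_kernelConv
        (measurable_conjPoissonLine y) hgm).aestronglyMeasurable hf.1
    rw [eLpNorm_one_eq_lintegral_enorm] at hhold
    refine (enorm_integral_le_lintegral_enorm _).trans (hhold.trans ?_)
    calc _ ≤ eLpNorm f (ENNReal.ofReal p) volume * (C * J ^ q⁻¹) := by gcongr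
      _ = _ := by ring
  rw [← ENNReal.rpow_rpow_inv hp0.ne' (eLpNorm _ _ _), eLpNorm_ofReal_rpow hp0, hJi]
  exact ENNReal.rpow_inv_le_of_le_mul_rpow_inv hpq hJtop hle

/-- M. Riesz's theorem, for conjugate Poisson means. -/
theorem exists_conjPoissonBoundedBy {p : ℝ} (hp : 1 < p) : ∃ C, ConjPoissonBoundedBy p C := by
  rcases le_or_gt p 2 with h | h
  · exact exists_conjPoissonBoundedBy_of_le_two hp h
  · have hpq := Real.HolderConjugate.conjExponent hp
    have hq2 : p.conjExponent ≤ 2 := by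
      rw [Real.conjExponent, div_le_iff₀ (by linarith)]; linarith
    obtain ⟨C, hC⟩ := exists_conjPoissonBoundedBy_of_le_two hpq.symm.lt hq2
    exact ⟨C, conjPoissonBoundedBy_of_holderConjugate hpq h hC⟩

/-! ### Convergence of Poisson means in L^p -/

lemma lintegral_comp_mul_left_real {a : ℝ} (ha : 0 < a) (h : ℝ → ℝ≥0∞) :
    ∫⁻ x, h (a * x) = ENNReal.ofReal a⁻¹ * ∫⁻ x, h x := by
  have h1 := (Homeomorph.mulLeft₀ a ha.ne').measurableEmbedding.lintegral_map
    (μ := (volume : Measure ℝ)) h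
  simp only [Homeomorph.coe_mulLeft₀] at h1
  rw [← h1, Real.map_volume_mul_left ha.ne', lintegral_smul_measure, abs_of_pos (inv_pos.2 ha),
    smul_eq_mul]

lemma poissonLine_mul {y : ℝ} (hy : 0 < y) (u : ℝ) : poissonLine y (y * u) = y⁻¹ * poissonLine 1 u := by
  unfold poissonLine; field_simp

lemma lintegral_poissonLine_mul_comp {y : ℝ} (hy : 0 < y) (ω : ℝ → ℝ≥0∞) :
    ∫⁻ s, ENNReal.ofReal (poissonLine y s) * ω s =
      ∫⁻ u, ENNReal.ofReal (poissonLine 1 u) * ω (y * u) := by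
  have h := lintegral_comp_mul_left_real hy fun s => ENNReal.ofReal (poissonLine y s) * ω s
  simp only [poissonLine_mul hy, ENNReal.ofReal_mul (inv_nonneg.2 hy.le), mul_assoc] at h
  rw [lintegral_const_mul' _ _ ENNReal.ofReal_ne_top] at h
  exact ((ENNReal.mul_right_inj (by simpa using hy) ENNReal.ofReal_ne_top).1 h).symm

/-- The deviation of a Poisson mean is controlled by the mean oscillation. -/
lemma enorm_kernelConv_poissonLine_sub_le {p : ℝ} (hp : 1 < p) {f : ℝ → ℂ}
    (hf : MemLp f (ENNReal.ofReal p)) {y : ℝ} (hy : 0 < y) (x : ℝ) :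
    ‖kernelConv (poissonLine y) f x - f x‖ₑ ≤
      ∫⁻ t, ENNReal.ofReal (poissonLine y (x - t)) * ‖f t - f x‖ₑ := by
  have hpq := Real.HolderConjugate.conjExponent hp
  have := hpq.ennrealOfReal
  have hP : Integrable fun t => ((poissonLine y (x - t) : ℝ) : ℂ) :=
    ((integrable_poissonLine hy).comp_sub_left x).ofReal
  have h1 : ∫ t, ((poissonLine y (x - t) : ℝ) : ℂ) = 1 := by
    have h : ∫ t : ℝ, (poissonLine y (x - t) : ℂ) = ((∫ t : ℝ, poissonLine y (x - t) : ℝ) : ℂ) :=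
      integral_ofReal
    rw [h, integral_sub_left_eq_self (poissonLine y) volume x,
      integral_poissonLine hy, Complex.ofReal_one]
  have h2 : kernelConv (poissonLine y) f x - f x =
      ∫ t, ((poissonLine y (x - t) : ℝ) : ℂ) * (f t - f x) := by
    simp only [mul_sub]
    rw [integral_sub (integrable_kernel_mul (memLp_poissonLine hy hpq.symm.lt) hf x)
      (hP.mul_const _), integral_mul_const, h1, one_mul, kernelConv]
  rw [h2]
  refine (enorm_integral_le_lintegral_enorm _).trans_eq (lintegral_congr fun t => ?_)
  rw [enorm_mul, enorm_ofReal_complex, Real.enorm_of_nonneg (poissonLine_nonneg hy _)]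

/-- Translation is continuous in `L^p`. -/
lemma tendsto_eLpNorm_comp_sub_sub {P : ℝ≥0∞} (hP1 : 1 ≤ P) (hP : P ≠ ∞) {f : ℝ → ℂ}
    (hf : MemLp f P) :
    Tendsto (fun s : ℝ => eLpNorm ((fun x => f (x - s)) - f) P volume) (𝓝 0) (𝓝 0) := by
  have : Fact (1 ≤ P) := ⟨hP1⟩
  let G : C(ℝ, C(ℝ, ℝ)) := (ContinuousMap.mk (fun z : ℝ × ℝ => z.2 - z.1) (by fun_prop)).curry
  have hG : ∀ s, MeasurePreserving (G s) volume volume := fun s =>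
    measurePreserving_sub_right volume s
  have h := Filter.Tendsto.compMeasurePreservingLp (μ := volume) (ν := volume)
    (tendsto_const_nhds (x := hf.toLp f) (f := 𝓝 (0 : ℝ))) (G.continuous.tendsto 0) hG (hG 0) hP
  have h0 : Lp.compMeasurePreserving (G 0) (hG 0) (hf.toLp f) = hf.toLp f := by
    rw [Lp.toLp_compMeasurePreserving]
    congr 1
    funext x
    simp [G]
  rw [h0] at h
  exact (Lp.tendsto_Lp_iff_tendsto_eLpNorm'' (fun s x => f (x - s))
    (fun s => hf.comp_measurePreserving (hG s)) f hf).1 h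

/-- The substitutions t = x - s and s = yu turn the averaged oscillation into the L^p modulus of
continuity of f integrated against the fixed kernel P_1, ready for dominated convergence as y → 0.
-/
lemma lintegral_lintegral_poissonLine_osc {y : ℝ} (hy : 0 < y) {f : ℝ → ℂ}
    (hf : StronglyMeasurable f) (p : ℝ) :
    ∫⁻ x, ∫⁻ t, ENNReal.ofReal (poissonLine y (x - t)) * ‖f t - f x‖ₑ ^ p =
      ∫⁻ u, ENNReal.ofReal (poissonLine 1 u) * ∫⁻ x, ‖f (x - y * u) - f x‖ₑ ^ p := by
  have hfm := hf.measurable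
  have hm : Measurable fun z : ℝ × ℝ => ‖f (z.1 - z.2) - f z.1‖ₑ ^ p := by fun_prop
  have hk : Measurable fun z : ℝ × ℝ => ENNReal.ofReal (poissonLine y z.2) :=
    ((measurable_poissonLine y).comp measurable_snd).ennreal_ofReal
  calc _ = ∫⁻ x, ∫⁻ s, ENNReal.ofReal (poissonLine y s) * ‖f (x - s) - f x‖ₑ ^ p := by
        refine lintegral_congr fun x => ?_
        rw [← lintegral_sub_left_eq_self _ x]
        simp
    _ = ∫⁻ s, ∫⁻ x, ENNReal.ofReal (poissonLine y s) * ‖f (x - s) - f x‖ₑ ^ p :=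
        lintegral_lintegral_swap (hk.mul hm).aemeasurable
    _ = ∫⁻ s, ENNReal.ofReal (poissonLine y s) * ∫⁻ x, ‖f (x - s) - f x‖ₑ ^ p :=
        lintegral_congr fun s => lintegral_const_mul' _ _ ENNReal.ofReal_ne_top
    _ = _ := lintegral_poissonLine_mul_comp hy fun s => ∫⁻ x, ‖f (x - s) - f x‖ₑ ^ p

/-- Poisson means converge in `L^p`. -/
lemma tendsto_eLpNorm_kernelConv_poissonLine_sub {p : ℝ} (hp : 1 < p) {f : ℝ → ℂ}
    (hf : MemLp f (ENNReal.ofReal p)) :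
    Tendsto (fun y => eLpNorm (kernelConv (poissonLine y) f - f) (ENNReal.ofReal p) volume)
      (𝓝[>] 0) (𝓝 0) := by
  wlog hfm : StronglyMeasurable f generalizing f
  · have h := this ((memLp_congr_ae hf.1.ae_eq_mk).1 hf) hf.1.stronglyMeasurable_mk
    refine h.congr fun y => eLpNorm_congr_ae ?_
    rw [kernelConv_congr _ hf.1.ae_eq_mk]
    exact (EventuallyEq.refl _ _).sub hf.1.ae_eq_mk.symm
  have hp0 : 0 < p := by linarith
  have hp1 : 1 ≤ ENNReal.ofReal p := by simpa using ENNReal.ofReal_le_ofReal hp.le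
  have hpq := Real.HolderConjugate.conjExponent hp
  set ω : ℝ → ℝ≥0∞ := fun s => ∫⁻ x, ‖f (x - s) - f x‖ₑ ^ p with hω
  have hωe : ∀ s, ω s = eLpNorm ((fun x => f (x - s)) - f) (ENNReal.ofReal p) volume ^ p :=
    fun s => (eLpNorm_ofReal_rpow hp0 _).symm
  have hfm' := hfm.measurable
  have hωm : Measurable ω := by
    have hm : Measurable fun z : ℝ × ℝ => ‖f (z.2 - z.1) - f z.2‖ₑ ^ p := by fun_prop
    exact hm.lintegral_prod_right'
  have hωb : ∀ s, ω s ≤ (2 * eLpNorm f (ENNReal.ofReal p) volume) ^ p := fun s => by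
    rw [hωe]
    refine ENNReal.rpow_le_rpow ?_ hp0.le
    have hτ := eLpNorm_comp_measurePreserving (p := ENNReal.ofReal p) hf.1
      (measurePreserving_sub_right volume s)
    refine (eLpNorm_sub_le ((hf.comp_measurePreserving
      (measurePreserving_sub_right volume s)).1) hf.1 hp1).trans ?_
    rw [two_mul]
    gcongr
    exact hτ.le
  have hω0 : Tendsto ω (𝓝 0) (𝓝 0) := by
    have h := (tendsto_eLpNorm_comp_sub_sub hp1 ENNReal.ofReal_ne_top hf).ennrpow_const p
    rw [ENNReal.zero_rpow_of_pos hp0] at h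
    exact h.congr fun s => (hωe s).symm
  have hb : ∀ y, 0 < y → eLpNorm (kernelConv (poissonLine y) f - f) (ENNReal.ofReal p) volume ≤
      (∫⁻ u, ENNReal.ofReal (poissonLine 1 u) * ω (y * u)) ^ p⁻¹ := fun y hy => by
    rw [ENNReal.le_rpow_inv_iff hp0, eLpNorm_ofReal_rpow hp0,
      ← lintegral_lintegral_poissonLine_osc hy hfm p]
    refine lintegral_mono fun x => ?_
    refine (ENNReal.rpow_le_rpow (enorm_kernelConv_poissonLine_sub_le hp hf hy x) hp0.le).trans ?_
    exact lintegral_poissonLine_rpow_le hpq hy (hfm'.sub_const _).enorm.aemeasurable x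
  -- The majorant is P_1(u) (2‖f‖_p)^p; pointwise convergence is continuity of translation in L^p.
  have hlim : Tendsto (fun y => ∫⁻ u, ENNReal.ofReal (poissonLine 1 u) * ω (y * u)) (𝓝[>] 0)
      (𝓝 (∫⁻ u : ℝ, 0)) := by
    refine tendsto_lintegral_filter_of_dominated_convergence
      (fun u => ENNReal.ofReal (poissonLine 1 u) * (2 * eLpNorm f (ENNReal.ofReal p) volume) ^ p)
      (Eventually.of_forall fun y => ?_) (Eventually.of_forall fun y =>
        Eventually.of_forall fun u => ?_) ?_ (Eventually.of_forall fun u => ?_)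
    · exact (measurable_poissonLine 1).ennreal_ofReal.mul (hωm.comp (measurable_const_mul y))
    · gcongr; exact hωb _
    · rw [lintegral_mul_const _ (measurable_poissonLine 1).ennreal_ofReal,
        lintegral_poissonLine one_pos, one_mul]
      exact ENNReal.rpow_ne_top_of_nonneg hp0.le
        (ENNReal.mul_ne_top ENNReal.ofNat_ne_top hf.eLpNorm_ne_top)
    · have h1 : Tendsto (fun y : ℝ => y * u) (𝓝[>] 0) (𝓝 0) := by
        have : Tendsto (fun y : ℝ => y * u) (𝓝 0) (𝓝 (0 * u)) :=
          (continuous_id.mul continuous_const).tendsto 0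
        rw [zero_mul] at this
        exact this.mono_left nhdsWithin_le_nhds
      simpa using ENNReal.Tendsto.const_mul (hω0.comp h1) (Or.inr ENNReal.ofReal_ne_top)
  rw [lintegral_zero] at hlim
  have hlim' := hlim.ennrpow_const p⁻¹
  rw [ENNReal.zero_rpow_of_pos (inv_pos.2 hp0)] at hlim'
  exact tendsto_of_tendsto_of_tendsto_of_le_of_le' tendsto_const_nhds hlim'
    (Eventually.of_forall fun _ => zero_le) (eventually_mem_nhdsWithin.mono fun y hy => hb y hy)

/-! ### The conjugate function in L^p -/

/-- Both orders of composition are used below: this one compares conjugate means at different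
heights through the Riesz bound, and the reverse one identifies the limit. -/
lemma kernelConv_conjPoissonLine_poissonLine {p : ℝ} (hp : 1 < p) {f : ℝ → ℂ}
    (hf : MemLp f (ENNReal.ofReal p)) {r s : ℝ} (hr : 0 < r) (hs : 0 < s) (x : ℝ) :
    kernelConv (conjPoissonLine s) (kernelConv (poissonLine r) f) x =
      kernelConv (conjPoissonLine (r + s)) f x := by
  have hpq := Real.HolderConjugate.conjExponent hp
  refine kernelConv_kernelConv (integrable_kernel_mul_poissonLine_mul hpq
    (measurable_conjPoissonLine s) (memLp_conjPoissonLine hs hpq.symm.lt) hr hf x) fun u => ?_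
  rw [← integral_poissonLine_mul_conjPoissonLine hr hs,
    ← integral_sub_left_eq_self (fun t => poissonLine r (u - t) * conjPoissonLine s t) volume u]
  simp only [sub_sub_cancel, mul_comm]

lemma kernelConv_poissonLine_conjPoissonLine {p : ℝ} (hp : 1 < p) {f : ℝ → ℂ}
    (hf : MemLp f (ENNReal.ofReal p)) {r s : ℝ} (hr : 0 < r) (hs : 0 < s) (x : ℝ) :
    kernelConv (poissonLine r) (kernelConv (conjPoissonLine s) f) x =
      kernelConv (conjPoissonLine (r + s)) f x := by
  have hpq := Real.HolderConjugate.conjExponent hp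
  have := hpq.ennrealOfReal
  exact kernelConv_kernelConv (integrable_kernel_mul_kernel_mul (measurable_poissonLine r)
    (measurable_conjPoissonLine s) (integrable_poissonLine hr)
    (memLp_conjPoissonLine hs hpq.symm.lt) hf x)
    (integral_poissonLine_mul_conjPoissonLine hr hs)

/-- |Q_y(u)| decreases in y, so |Q_r| dominates every |Q_(r+s)|. -/
lemma tendsto_kernelConv_conjPoissonLine_add {p : ℝ} (hp : 1 < p) {f : ℝ → ℂ}
    (hf : MemLp f (ENNReal.ofReal p)) {r : ℝ} (hr : 0 < r) {s : ℕ → ℝ} (hs : ∀ n, 0 < s n)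
    (hs0 : Tendsto s atTop (𝓝 0)) (x : ℝ) :
    Tendsto (fun n => kernelConv (conjPoissonLine (r + s n)) f x) atTop
      (𝓝 (kernelConv (conjPoissonLine r) f x)) := by
  have hpq := Real.HolderConjugate.conjExponent hp
  have := hpq.ennrealOfReal
  refine tendsto_integral_of_dominated_convergence
    (fun t => ‖((conjPoissonLine r (x - t) : ℝ) : ℂ) * f t‖)
    (fun n => (integrable_kernel_mul
      (memLp_conjPoissonLine (add_pos hr (hs n)) hpq.symm.lt) hf x).1)
    (integrable_kernel_mul (memLp_conjPoissonLine hr hpq.symm.lt) hf x).norm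
    (fun n => Eventually.of_forall fun t => ?_) (Eventually.of_forall fun t => ?_)
  · rw [norm_mul, norm_mul, Complex.norm_real, Complex.norm_real]
    gcongr
    unfold conjPoissonLine
    rw [norm_mul, norm_mul, norm_div, norm_div]
    have h1 : 0 < (x - t) ^ 2 + r ^ 2 := by positivity
    have h2 : (x - t) ^ 2 + r ^ 2 ≤ (x - t) ^ 2 + (r + s n) ^ 2 := by
      gcongr; linarith [hs n]
    rw [Real.norm_of_nonneg h1.le, Real.norm_of_nonneg (h1.le.trans h2)]
    gcongr
  · refine Tendsto.mul_const _ ((Complex.continuous_ofReal.tendsto _).comp ?_)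
    unfold conjPoissonLine
    refine Tendsto.const_mul _ (tendsto_const_nhds.div (tendsto_const_nhds.add ?_) (by positivity))
    simpa using (hs0.const_add r).pow 2

lemma memLp_kernelConv_conjPoissonLine {p : ℝ} (hp : 1 < p) {f : ℝ → ℂ}
    (hf : MemLp f (ENNReal.ofReal p)) {y : ℝ} (hy : 0 < y) :
    MemLp (kernelConv (conjPoissonLine y) f) (ENNReal.ofReal p) := by
  obtain ⟨C, hC⟩ := exists_conjPoissonBoundedBy hp
  exact ⟨(stronglyMeasurable_kernelConv (measurable_conjPoissonLine y) hf.1).aestronglyMeasurable,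
    (hC f hf y hy).trans_lt (ENNReal.mul_lt_top ENNReal.coe_lt_top hf.2)⟩

/-- The Hilbert transform of `f ∈ L^p`, found in `L^p` as the function whose Poisson means are the
conjugate Poisson means of `f`. -/
theorem exists_memLp_conjugate {p : ℝ} (hp : 1 < p) {f : ℝ → ℂ}
    (hf : MemLp f (ENNReal.ofReal p)) :
    ∃ g : ℝ → ℂ, MemLp g (ENNReal.ofReal p) ∧ ∀ y, 0 < y → ∀ x,
      kernelConv (conjPoissonLine y) f x = kernelConv (poissonLine y) g x := by
  obtain ⟨C, hC⟩ := exists_conjPoissonBoundedBy hp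
  have hpq := Real.HolderConjugate.conjExponent hp
  have := hpq.ennrealOfReal
  have hp1 : 1 ≤ ENNReal.ofReal p := by simpa using ENNReal.ofReal_le_ofReal hp.le
  have : Fact (1 ≤ ENNReal.ofReal p) := ⟨hp1⟩
  set r : ℕ → ℝ := fun n => 1 / ((n : ℝ) + 1)
  have hr : ∀ n, 0 < r n := fun n => Nat.one_div_pos_of_nat
  have hr0 : Tendsto r atTop (𝓝 0) := tendsto_one_div_add_atTop_nhds_zero_nat
  have hu : ∀ n, MemLp (kernelConv (poissonLine (r n)) f) (ENNReal.ofReal p) :=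
    fun n => memLp_kernelConv_poissonLine hp (hr n) hf
  have hv : ∀ n, MemLp (kernelConv (conjPoissonLine (r n)) f) (ENNReal.ofReal p) :=
    fun n => memLp_kernelConv_conjPoissonLine hp hf (hr n)
  -- The difference on the left is the pointwise limit, as k → ∞, of Q_(r k) applied to the
  -- difference of Poisson means. The Riesz bound is uniform in k, and Fatou preserves it.
  have hcmp : ∀ n m, eLpNorm (kernelConv (conjPoissonLine (r n)) f -
      kernelConv (conjPoissonLine (r m)) f) (ENNReal.ofReal p) volume ≤
      C * eLpNorm (kernelConv (poissonLine (r n)) f - kernelConv (poissonLine (r m)) f)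
        (ENNReal.ofReal p) volume := by
    intro n m
    have hk : ∀ k x, kernelConv (conjPoissonLine (r k)) (kernelConv (poissonLine (r n)) f -
        kernelConv (poissonLine (r m)) f) x = kernelConv (conjPoissonLine (r n + r k)) f x -
        kernelConv (conjPoissonLine (r m + r k)) f x := fun k x => by
      rw [kernelConv_sub (memLp_conjPoissonLine (hr k) hpq.symm.lt) (hu n) (hu m),
        kernelConv_conjPoissonLine_poissonLine hp hf (hr n) (hr k),
        kernelConv_conjPoissonLine_poissonLine hp hf (hr m) (hr k)]
    refine (Lp.eLpNorm_lim_le_liminf_eLpNorm (f := fun k => kernelConv (conjPoissonLine (r k))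
      (kernelConv (poissonLine (r n)) f - kernelConv (poissonLine (r m)) f))
      (fun k => (stronglyMeasurable_kernelConv (measurable_conjPoissonLine _)
        ((hu n).sub (hu m)).1).aestronglyMeasurable) _ (Eventually.of_forall fun x => ?_)).trans ?_
    · simp only [hk]
      exact (tendsto_kernelConv_conjPoissonLine_add hp hf (hr n) hr hr0 x).sub
        (tendsto_kernelConv_conjPoissonLine_add hp hf (hr m) hr hr0 x)
    · refine liminf_le_of_le ⟨0, by simp⟩ fun b hb => ?_
      obtain ⟨k, hk⟩ := hb.exists
      exact hk.trans (hC _ ((hu n).sub (hu m)) _ (hr k))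
  have hucauchy : CauchySeq fun n => (hu n).toLp := by
    refine Tendsto.cauchySeq (x := hf.toLp) ((Lp.tendsto_Lp_iff_tendsto_eLpNorm'' _ hu f hf).2 ?_)
    exact (tendsto_eLpNorm_kernelConv_poissonLine_sub hp hf).comp
      (tendsto_nhdsWithin_iff.2 ⟨hr0, Eventually.of_forall hr⟩)
  have hvcauchy : CauchySeq fun n => (hv n).toLp := by
    rw [EMetric.cauchySeq_iff] at hucauchy ⊢
    intro ε hε
    -- Dividing by C + 1 covers C = 0.
    obtain ⟨N, hN⟩ := hucauchy (ε / (C + 1)) (ENNReal.div_pos hε.ne' (by finiteness))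
    refine ⟨N, fun m hm n hn => ?_⟩
    have h := hN m hm n hn
    rw [Lp.edist_toLp_toLp] at h ⊢
    refine (hcmp m n).trans_lt ?_
    have h2 := (ENNReal.lt_div_iff_mul_lt (Or.inl (by positivity)) (Or.inl (by finiteness))).1 h
    refine lt_of_le_of_lt ?_ h2
    rw [mul_comm]
    gcongr
    exact le_self_add
  obtain ⟨G, hG⟩ := cauchySeq_tendsto_of_complete hvcauchy
  have hGm := Lp.memLp G
  refine ⟨G, hGm, fun y hy x => ?_⟩
  have hG' : Tendsto (fun n => eLpNorm (kernelConv (conjPoissonLine (r n)) f - (G : ℝ → ℂ))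
      (ENNReal.ofReal p) volume) atTop (𝓝 0) := by
    refine (Lp.tendsto_Lp_iff_tendsto_eLpNorm'' _ hv G hGm).1 ?_
    rwa [Lp.toLp_coeFn]
  -- P_y * (Q_(r n) * f) = Q_(y + r n) * f has two pointwise limits: P_y * G by L^p convergence, and
  -- Q_y * f by continuity in the height.
  have h1 := tendsto_kernelConv_of_eLpNorm (memLp_poissonLine hy hpq.symm.lt) hv hGm hG' x
  have h2 := tendsto_kernelConv_conjPoissonLine_add hp hf hy hr hr0 x
  refine tendsto_nhds_unique h2 (h1.congr fun n => ?_)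
  exact kernelConv_poissonLine_conjPoissonLine hp hf hy (hr n) x

/-! ### Poisson means at Lebesgue points -/

lemma poissonLine_le_inv {y : ℝ} (hy : 0 < y) {s r : ℝ} (hr : 0 < r) (hs : r ≤ |s|) :
    poissonLine y s ≤ y / r ^ 2 := by
  have hpi : Real.pi⁻¹ ≤ 1 := inv_le_one_of_one_le₀ (by linarith [Real.pi_gt_three])
  have h1 : r ^ 2 ≤ s ^ 2 + y ^ 2 := by
    rw [← sq_abs s]; nlinarith [sq_nonneg y]
  calc poissonLine y s ≤ 1 * (y / r ^ 2) := by unfold poissonLine; gcongr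
    _ = _ := one_mul _

lemma poissonLine_le_one_div {y : ℝ} (hy : 0 < y) (s : ℝ) : poissonLine y s ≤ 1 / y := by
  have hpi : Real.pi⁻¹ ≤ 1 := inv_le_one_of_one_le₀ (by linarith [Real.pi_gt_three])
  have h1 : y / (s ^ 2 + y ^ 2) ≤ 1 / y := by
    rw [div_le_div_iff₀ (by positivity) hy]; nlinarith [sq_nonneg s]
  calc poissonLine y s ≤ 1 * (1 / y) := by unfold poissonLine; gcongr
    _ = _ := one_mul _

/-- Dyadic majorant of the Poisson kernel. -/
lemma exists_poissonLine_le_dyadic {y : ℝ} (hy : 0 < y) (s : ℝ) :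
    ∃ k : ℕ, |s| ≤ 2 ^ k * y ∧ poissonLine y s ≤ 4 * (1 / 4) ^ k / y := by
  have hex : ∃ k : ℕ, |s| ≤ 2 ^ k * y := by
    obtain ⟨k, hk⟩ := pow_unbounded_of_one_lt (|s| / y) (one_lt_two (α := ℝ))
    exact ⟨k, ((div_lt_iff₀ hy).1 hk).le⟩
  classical
  -- For the least k, either k = 0 or |s| > 2^(k-1) y. In the second case P_y(s) ≤ y / (2^(k-1) y)^2
  -- = 4 · 4^(-k) / y.
  refine ⟨Nat.find hex, Nat.find_spec hex, ?_⟩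
  rcases hk : Nat.find hex with _ | k
  · refine (poissonLine_le_one_div hy s).trans ?_
    rw [pow_zero]; gcongr; norm_num
  · have h1 : 2 ^ k * y ≤ |s| := (not_le.1 (Nat.find_min hex (m := k) (by omega))).le
    refine (poissonLine_le_inv hy (by positivity) h1).trans_eq ?_
    have h4 : ((2 : ℝ) ^ k) ^ 2 = 4 ^ k := by rw [← pow_mul, mul_comm, pow_mul]; norm_num
    rw [mul_pow, h4, one_div, inv_pow, pow_succ (4 : ℝ) k]
    field_simp

/-- At dyadic scale k the majorant 4 · 4^(-k) / y meets mass at most ε 2^k y, contributing 4ε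
2^(-k); the sum is 8ε. Scales beyond δ cause no loss, since only the part inside the δ-ball counts.
-/
lemma lintegral_poissonLine_mul_closedBall_le {h : ℝ → ℝ≥0∞} (hh : AEMeasurable h) {x δ ε : ℝ}
    (hδ : 0 < δ) (hε : 0 ≤ ε)
    (H : ∀ r, 0 < r → r ≤ δ → ∫⁻ t in Metric.closedBall x r, h t ≤ ENNReal.ofReal (ε * r))
    {y : ℝ} (hy : 0 < y) :
    ∫⁻ t in Metric.closedBall x δ, ENNReal.ofReal (poissonLine y (x - t)) * h t ≤
      ENNReal.ofReal (8 * ε) := by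
  have hpt : ∀ t, ENNReal.ofReal (poissonLine y (x - t)) * h t ≤
      ∑' k : ℕ, (Metric.closedBall x (2 ^ k * y)).indicator
        (fun t => ENNReal.ofReal (4 * (1 / 4) ^ k / y) * h t) t := fun t => by
    obtain ⟨k, hk, hk'⟩ := exists_poissonLine_le_dyadic hy (x - t)
    refine le_trans ?_ (ENNReal.le_tsum k)
    have hmem : t ∈ Metric.closedBall x (2 ^ k * y) := by
      rwa [Metric.mem_closedBall, dist_comm, Real.dist_eq]
    rw [indicator_of_mem hmem]
    gcongr
  have hball : ∀ r, 0 < r →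
      ∫⁻ t in Metric.closedBall x r ∩ Metric.closedBall x δ, h t ≤ ENNReal.ofReal (ε * r) := by
    intro r hr
    rcases le_total r δ with hrδ | hrδ
    · exact (lintegral_mono_set inter_subset_left).trans (H r hr hrδ)
    · exact (lintegral_mono_set inter_subset_right).trans
        ((H δ hδ le_rfl).trans (ENNReal.ofReal_le_ofReal (by gcongr)))
  calc ∫⁻ t in Metric.closedBall x δ, ENNReal.ofReal (poissonLine y (x - t)) * h t
      ≤ ∫⁻ t in Metric.closedBall x δ, ∑' k : ℕ, (Metric.closedBall x (2 ^ k * y)).indicator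
        (fun t => ENNReal.ofReal (4 * (1 / 4) ^ k / y) * h t) t := lintegral_mono hpt
    _ = ∑' k : ℕ, ∫⁻ t in Metric.closedBall x δ, (Metric.closedBall x (2 ^ k * y)).indicator
        (fun t => ENNReal.ofReal (4 * (1 / 4) ^ k / y) * h t) t :=
        lintegral_tsum fun k =>
          ((hh.const_mul _).restrict).indicator Metric.isClosed_closedBall.measurableSet
    _ ≤ ∑' k : ℕ, ENNReal.ofReal (4 * ε * (1 / 2) ^ k) := by
        refine ENNReal.tsum_le_tsum fun k => ?_
        rw [lintegral_indicator Metric.isClosed_closedBall.measurableSet,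
          Measure.restrict_restrict Metric.isClosed_closedBall.measurableSet,
          lintegral_const_mul' _ _ ENNReal.ofReal_ne_top]
        calc _ ≤ ENNReal.ofReal (4 * (1 / 4) ^ k / y) * ENNReal.ofReal (ε * (2 ^ k * y)) := by
              gcongr; exact hball _ (by positivity)
          _ = _ := by
              rw [← ENNReal.ofReal_mul (by positivity)]
              congr 1
              have h4 : ((1 : ℝ) / 4) ^ k = (1 / 2) ^ k * (1 / 2) ^ k := by
                rw [← mul_pow]; norm_num
              have h2 : ((1 : ℝ) / 2) ^ k * 2 ^ k = 1 := by rw [← mul_pow]; norm_num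
              rw [h4]
              field_simp
              linear_combination ε * h2
    _ = ENNReal.ofReal (8 * ε) := by
        rw [← ENNReal.ofReal_tsum_of_nonneg (fun k => by positivity)
          (summable_geometric_two.mul_left _), tsum_mul_left, tsum_geometric_two]
        congr 1; ring

/-- Off the δ-ball P_y ≤ y (1 + 1/δ²) P_1, so the tail is O(y) as soon as the integral against P_1
is finite. -/
lemma lintegral_poissonLine_mul_compl_closedBall_le (h : ℝ → ℝ≥0∞) {x δ : ℝ} (hδ : 0 < δ)
    {y : ℝ} (hy : 0 < y) :
    ∫⁻ t in (Metric.closedBall x δ)ᶜ, ENNReal.ofReal (poissonLine y (x - t)) * h t ≤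
      ENNReal.ofReal (y * (1 + 1 / δ ^ 2)) *
        ∫⁻ t, ENNReal.ofReal (poissonLine 1 (x - t)) * h t := by
  rw [← lintegral_const_mul' _ _ ENNReal.ofReal_ne_top]
  refine le_trans ?_ (setLIntegral_le_lintegral (Metric.closedBall x δ)ᶜ _)
  refine setLIntegral_mono' Metric.isClosed_closedBall.measurableSet.compl fun t ht => ?_
  rw [← mul_assoc, ← ENNReal.ofReal_mul (by positivity)]
  gcongr
  have hs : δ < |x - t| := by
    rwa [mem_compl_iff, Metric.mem_closedBall, dist_comm, Real.dist_eq, not_le] at ht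
  have hsq : δ ^ 2 ≤ (x - t) ^ 2 := by rw [← sq_abs (x - t)]; gcongr
  have hpos : 0 < (x - t) ^ 2 := lt_of_lt_of_le (by positivity) hsq
  unfold poissonLine
  have key : y / ((x - t) ^ 2 + y ^ 2) ≤ y * (1 + 1 / δ ^ 2) * (1 / ((x - t) ^ 2 + 1 ^ 2)) := by
    have h1 : 1 / ((x - t) ^ 2 + y ^ 2) ≤ (1 + 1 / δ ^ 2) * (1 / ((x - t) ^ 2 + 1 ^ 2)) := by
      rw [mul_one_div, div_le_div_iff₀ (by positivity) (by positivity)]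
      have h2 : 1 ≤ 1 / δ ^ 2 * (x - t) ^ 2 := by
        rw [one_div_mul_eq_div, le_div_iff₀ (by positivity)]; linarith
      have h3 : 0 ≤ 1 / δ ^ 2 * y ^ 2 := by positivity
      nlinarith [sq_nonneg y]
    calc _ = y * (1 / ((x - t) ^ 2 + y ^ 2)) := by ring
      _ ≤ y * ((1 + 1 / δ ^ 2) * (1 / ((x - t) ^ 2 + 1 ^ 2))) := by gcongr
      _ = _ := by ring
  calc _ ≤ Real.pi⁻¹ * (y * (1 + 1 / δ ^ 2) * (1 / ((x - t) ^ 2 + 1 ^ 2))) := by gcongr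
    _ = _ := by ring

lemma locallyIntegrable_of_memLp {p : ℝ} (hp : 1 < p) {f : ℝ → ℂ}
    (hf : MemLp f (ENNReal.ofReal p)) : LocallyIntegrable f :=
  hf.locallyIntegrable (by simpa using ENNReal.ofReal_le_ofReal hp.le)

lemma lintegral_poissonLine_osc_lt_top {p : ℝ} (hp : 1 < p) {f : ℝ → ℂ}
    (hf : MemLp f (ENNReal.ofReal p)) {y : ℝ} (hy : 0 < y) (x : ℝ) :
    ∫⁻ t, ENNReal.ofReal (poissonLine y (x - t)) * ‖f t - f x‖ₑ < ∞ := by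
  have hpq := Real.HolderConjugate.conjExponent hp
  have := hpq.ennrealOfReal
  have hP : Integrable fun t => ((poissonLine y (x - t) : ℝ) : ℂ) :=
    ((integrable_poissonLine hy).comp_sub_left x).ofReal
  have h := (integrable_kernel_mul (memLp_poissonLine hy hpq.symm.lt) hf x).sub
    (hP.mul_const (f x))
  have h2 := hasFiniteIntegral_iff_enorm.1 h.2
  refine lt_of_eq_of_lt (lintegral_congr fun t => ?_) h2
  rw [Pi.sub_apply, ← mul_sub, enorm_mul, enorm_ofReal_complex,
    Real.enorm_of_nonneg (poissonLine_nonneg hy _)]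

/-- At almost every point the Poisson means of the oscillation of `f` tend to zero. -/
lemma ae_tendsto_lintegral_poissonLine_osc {p : ℝ} (hp : 1 < p) {f : ℝ → ℂ}
    (hf : MemLp f (ENNReal.ofReal p)) :
    ∀ᵐ x, Tendsto (fun y => ∫⁻ t, ENNReal.ofReal (poissonLine y (x - t)) * ‖f t - f x‖ₑ)
      (𝓝[>] 0) (𝓝 0) := by
  have hloc := locallyIntegrable_of_memLp hp hf
  filter_upwards [IsUnifLocDoublingMeasure.ae_tendsto_average_norm_sub volume hloc 1] with x hx
  have hx' := hx (l := 𝓝[>] (0 : ℝ)) (fun _ => x) (fun r => r) tendsto_id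
    (eventually_mem_nhdsWithin.mono fun r hr => by
      rw [one_mul]; exact Metric.mem_closedBall_self (le_of_lt hr))
  have hball : ∀ ε : ℝ, 0 < ε → ∃ δ : ℝ, 0 < δ ∧ ∀ r, 0 < r → r ≤ δ →
      ∫⁻ t in Metric.closedBall x r, ‖f t - f x‖ₑ ≤ ENNReal.ofReal (ε * r) := by
    intro ε hε
    -- The ball has length 2r, so an average below ε/2 means an integral below εr.
    have h1 := hx'.eventually (gt_mem_nhds (half_pos hε))
    obtain ⟨δ, hδ, hδ'⟩ := mem_nhdsGT_iff_exists_Ioc_subset.1 h1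
    refine ⟨δ, hδ, fun r hr hrδ => ?_⟩
    have h2 : ⨍ t in Metric.closedBall x r, ‖f t - f x‖ < ε / 2 := hδ' ⟨hr, hrδ⟩
    have hint : IntegrableOn (fun t => f t - f x) (Metric.closedBall x r) :=
      (hloc.integrableOn_isCompact (isCompact_closedBall x r)).sub
        (integrableOn_const measure_closedBall_lt_top.ne)
    rw [setAverage_eq, Measure.real, Real.volume_closedBall, ENNReal.toReal_ofReal (by positivity),
      smul_eq_mul, inv_mul_lt_iff₀ (by positivity)] at h2
    rw [← ofReal_integral_norm_eq_lintegral_enorm hint]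
    exact ENNReal.ofReal_le_ofReal (by linarith)
  rw [ENNReal.tendsto_nhds_zero]
  intro η hη
  -- The budget 9ε is 8ε for the ball and ε for the tail.
  obtain ⟨ε, hε, hεη⟩ : ∃ ε : ℝ, 0 < ε ∧ ENNReal.ofReal (9 * ε) ≤ η := by
    rcases eq_or_ne η ∞ with rfl | hη'
    · exact ⟨1, one_pos, le_top⟩
    · refine ⟨η.toReal / 9, div_pos (ENNReal.toReal_pos hη.ne' hη') (by norm_num), ?_⟩
      rw [mul_div_cancel₀ _ (by norm_num), ENNReal.ofReal_toReal hη']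
  obtain ⟨δ, hδ, hδ'⟩ := hball ε hε
  set T := ∫⁻ t, ENNReal.ofReal (poissonLine 1 (x - t)) * ‖f t - f x‖ₑ with hT
  have hTtop : T ≠ ∞ := (lintegral_poissonLine_osc_lt_top hp hf one_pos x).ne
  have htail : Tendsto (fun y : ℝ => ENNReal.ofReal (y * (1 + 1 / δ ^ 2)) * T) (𝓝[>] 0) (𝓝 0) := by
    have h1 : Tendsto (fun y : ℝ => y * (1 + 1 / δ ^ 2)) (𝓝[>] 0) (𝓝 0) := by
      have : Tendsto (fun y : ℝ => y * (1 + 1 / δ ^ 2)) (𝓝 0) (𝓝 (0 * (1 + 1 / δ ^ 2))) :=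
        (continuous_id.mul continuous_const).tendsto 0
      rw [zero_mul] at this
      exact this.mono_left nhdsWithin_le_nhds
    have h2 := ENNReal.Tendsto.mul_const (ENNReal.tendsto_ofReal h1) (Or.inr hTtop)
    simpa using h2
  have hev := htail.eventually (ge_mem_nhds (ENNReal.ofReal_pos.2 hε))
  filter_upwards [hev, eventually_mem_nhdsWithin] with y hy1 hy
  have hy : 0 < y := hy
  refine le_trans ?_ hεη
  have hm : AEMeasurable fun t => ‖f t - f x‖ₑ :=
    (hf.1.sub aestronglyMeasurable_const).enorm
  rw [← lintegral_add_compl _ (Metric.isClosed_closedBall (x := x) (ε := δ)).measurableSet,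
    show 9 * ε = 8 * ε + ε by ring, ENNReal.ofReal_add (by positivity) hε.le]
  exact add_le_add (lintegral_poissonLine_mul_closedBall_le hm hδ hε.le hδ' hy)
    ((lintegral_poissonLine_mul_compl_closedBall_le _ hδ hy).trans hy1)

/-! ### Truncated Hilbert transforms and principal values -/

/-- The kernel of the truncated Hilbert transform. -/
noncomputable def truncatedHilbertKernel (ε u : ℝ) : ℝ :=
  {u : ℝ | ε < |u|}.indicator (fun u => Real.pi⁻¹ * u⁻¹) u

lemma truncatedHilbertKernel_of_lt {ε u : ℝ} (h : ε < |u|) :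
    truncatedHilbertKernel ε u = Real.pi⁻¹ * u⁻¹ :=
  indicator_of_mem (s := {u : ℝ | ε < |u|}) h _

lemma truncatedHilbertKernel_of_not_lt {ε u : ℝ} (h : ¬ε < |u|) :
    truncatedHilbertKernel ε u = 0 :=
  indicator_of_notMem (s := {u : ℝ | ε < |u|}) h _

lemma measurable_truncatedHilbertKernel (ε : ℝ) : Measurable (truncatedHilbertKernel ε) := by
  have h : Measurable fun u : ℝ => Real.pi⁻¹ * u⁻¹ := by fun_prop
  exact h.indicator (measurableSet_lt measurable_const measurable_norm)

lemma memLp_truncatedHilbertKernel {ε q : ℝ} (hε : 0 < ε) (hq : 1 < q) :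
    MemLp (truncatedHilbertKernel ε) (ENNReal.ofReal q) := by
  refine memLp_of_le_inv_one_add_abs (measurable_truncatedHilbertKernel ε) (c := 1 + ε⁻¹)
    (fun u => ?_) hq
  have hpi : Real.pi⁻¹ ≤ 1 := inv_le_one_of_one_le₀ (by linarith [Real.pi_gt_three])
  by_cases hu : ε < |u|
  · rw [truncatedHilbertKernel_of_lt hu, abs_mul, abs_inv, abs_inv,
      abs_of_pos Real.pi_pos]
    have hup : 0 < |u| := hε.trans hu
    have h1 : |u|⁻¹ ≤ (1 + ε⁻¹) * (1 + |u|)⁻¹ := by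
      rw [← div_eq_mul_inv, inv_eq_one_div, div_le_div_iff₀ hup (by positivity)]
      have : 1 ≤ ε⁻¹ * |u| := by rw [inv_mul_eq_div, le_div_iff₀ hε]; linarith
      linarith
    calc _ ≤ 1 * |u|⁻¹ := by gcongr
      _ ≤ _ := by rwa [one_mul]
  · rw [truncatedHilbertKernel_of_not_lt hu, abs_zero]; positivity

lemma truncatedHilbertKernel_mul (ε : ℝ) (f : ℝ → ℂ) (x t : ℝ) :
    ((truncatedHilbertKernel ε (x - t) : ℝ) : ℂ) * f t = {t : ℝ | ε < |x - t|}.indicator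
      (fun t => ((1 / Real.pi : ℝ) : ℂ) * (f t / ((x - t : ℝ) : ℂ))) t := by
  by_cases h : ε < |x - t|
  · rw [truncatedHilbertKernel_of_lt h, indicator_of_mem (s := {t : ℝ | ε < |x - t|}) h]
    push_cast; ring
  · rw [truncatedHilbertKernel_of_not_lt h, indicator_of_notMem (s := {t : ℝ | ε < |x - t|}) h]
    simp

lemma measurableSet_lt_abs_sub (ε x : ℝ) : MeasurableSet {t : ℝ | ε < |x - t|} :=
  measurableSet_lt measurable_const (measurable_id.const_sub x).norm

lemma truncatedHilbert_eq_kernelConv (ε : ℝ) (f : ℝ → ℂ) (x : ℝ) :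
    truncatedHilbert ε f x = kernelConv (truncatedHilbertKernel ε) f x := by
  simp only [kernelConv, truncatedHilbertKernel_mul]
  rw [integral_indicator (measurableSet_lt_abs_sub ε x), integral_const_mul, truncatedHilbert]

lemma integrableOn_truncatedHilbert {p : ℝ} (hp : 1 < p) {f : ℝ → ℂ}
    (hf : MemLp f (ENNReal.ofReal p)) {ε : ℝ} (hε : 0 < ε) (x : ℝ) :
    IntegrableOn (fun t : ℝ => f t / ((x - t : ℝ) : ℂ)) {t : ℝ | ε < |x - t|} := by
  have hpq := Real.HolderConjugate.conjExponent hp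
  have := hpq.ennrealOfReal
  have h := integrable_kernel_mul (memLp_truncatedHilbertKernel hε hpq.symm.lt) hf x
  simp only [truncatedHilbertKernel_mul] at h
  rw [integrable_indicator_iff (measurableSet_lt_abs_sub ε x)] at h
  refine (h.const_mul (Real.pi : ℂ)).congr (Eventually.of_forall fun t => ?_)
  have : (Real.pi : ℂ) ≠ 0 := Complex.ofReal_ne_zero.2 Real.pi_ne_zero
  push_cast
  field_simp

/-- Truncation and height share the scale y. Beyond y the difference has modulus y² / (π |u| (u² +
y²)) with y/|u| < 1; up to y it is -Q_y(u) with |u| ≤ y. -/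
lemma abs_truncatedHilbertKernel_sub_le {y : ℝ} (hy : 0 < y) (u : ℝ) :
    |truncatedHilbertKernel y u - conjPoissonLine y u| ≤ poissonLine y u := by
  have hpi := Real.pi_pos
  unfold poissonLine conjPoissonLine
  by_cases hu : y < |u|
  · have hu0 : u ≠ 0 := fun h => by rw [h, abs_zero] at hu; linarith
    have hup : 0 < |u| := abs_pos.2 hu0
    have h1 : Real.pi⁻¹ * u⁻¹ - Real.pi⁻¹ * (u / (u ^ 2 + y ^ 2)) =
        Real.pi⁻¹ * (y ^ 2 / (u * (u ^ 2 + y ^ 2))) := by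
      field_simp; ring
    rw [truncatedHilbertKernel_of_lt hu, h1, abs_mul, abs_div, abs_mul,
      abs_of_pos (inv_pos.2 hpi), abs_of_pos (a := y ^ 2) (by positivity),
      abs_of_pos (a := u ^ 2 + y ^ 2) (by positivity)]
    gcongr ?_ * ?_
    rw [div_le_div_iff₀ (by positivity) (by positivity)]
    have h2 : y ^ 2 ≤ y * |u| := by nlinarith
    calc _ ≤ (y * |u|) * (u ^ 2 + y ^ 2) := by gcongr
      _ = _ := by ring
  · rw [truncatedHilbertKernel_of_not_lt hu, zero_sub, abs_neg, abs_mul, abs_div,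
      abs_of_pos (inv_pos.2 hpi), abs_of_pos (a := u ^ 2 + y ^ 2) (by positivity)]
    gcongr
    exact not_lt.1 hu

lemma truncatedHilbertKernel_neg (y u : ℝ) :
    truncatedHilbertKernel y (-u) = -truncatedHilbertKernel y u := by
  by_cases hu : y < |u|
  · rw [truncatedHilbertKernel_of_lt hu, truncatedHilbertKernel_of_lt (by rwa [abs_neg]), inv_neg,
      mul_neg]
  · rw [truncatedHilbertKernel_of_not_lt hu, truncatedHilbertKernel_of_not_lt (by rwa [abs_neg]),
      neg_zero]

/-- The truncated Hilbert transform and the conjugate Poisson mean differ by at most the Poisson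
mean of the oscillation. -/
lemma enorm_truncatedHilbert_sub_le {p : ℝ} (hp : 1 < p) {f : ℝ → ℂ}
    (hf : MemLp f (ENNReal.ofReal p)) {y : ℝ} (hy : 0 < y) (x : ℝ) :
    ‖truncatedHilbert y f x - kernelConv (conjPoissonLine y) f x‖ₑ ≤
      ∫⁻ t, ENNReal.ofReal (poissonLine y (x - t)) * ‖f t - f x‖ₑ := by
  have hpq := Real.HolderConjugate.conjExponent hp
  have := hpq.ennrealOfReal
  set D : ℝ → ℝ := fun u => truncatedHilbertKernel y u - conjPoissonLine y u with hD
  have hDi : Integrable D := by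
    refine (integrable_poissonLine hy).mono' ((measurable_truncatedHilbertKernel y).sub
      (measurable_conjPoissonLine y)).aestronglyMeasurable (Eventually.of_forall fun u => ?_)
    exact abs_truncatedHilbertKernel_sub_le hy u
  -- D is odd, so the constant f(x) can be subtracted from f under the convolution; this is what
  -- brings in the oscillation.
  have hD0 : ∫ u, D u = 0 := by
    have h1 : ∫ u, D (-u) = ∫ u, D u := integral_neg_eq_self D volume
    have h2 : ∀ u, D (-u) = -D u := fun u => by
      simp only [hD, truncatedHilbertKernel_neg, conjPoissonLine_neg]; ring
    simp only [h2, integral_neg] at h1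
    linarith
  have hDx : Integrable fun t => ((D (x - t) : ℝ) : ℂ) := (hDi.comp_sub_left x).ofReal
  have hD1 : ∫ t, ((D (x - t) : ℝ) : ℂ) = 0 := by
    have h : ∫ t : ℝ, (D (x - t) : ℂ) = ((∫ t : ℝ, D (x - t) : ℝ) : ℂ) := integral_ofReal
    rw [h, integral_sub_left_eq_self D volume x, hD0, Complex.ofReal_zero]
  have hT := integrable_kernel_mul (memLp_truncatedHilbertKernel hy hpq.symm.lt) hf x
  have hQ := integrable_kernel_mul (memLp_conjPoissonLine hy hpq.symm.lt) hf x
  have hDf : ∀ t, ((D (x - t) : ℝ) : ℂ) * f t = ((truncatedHilbertKernel y (x - t) : ℝ) : ℂ) * f t -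
      ((conjPoissonLine y (x - t) : ℝ) : ℂ) * f t := fun t => by
    simp only [hD]; push_cast; ring
  have h2 : truncatedHilbert y f x - kernelConv (conjPoissonLine y) f x =
      ∫ t, ((D (x - t) : ℝ) : ℂ) * (f t - f x) := by
    simp only [mul_sub]
    rw [integral_sub _ (hDx.mul_const _), integral_mul_const, hD1, zero_mul, sub_zero]
    · simp only [hDf]
      rw [integral_sub hT hQ, truncatedHilbert_eq_kernelConv]
      rfl
    · simp only [hDf]
      exact hT.sub hQ
  rw [h2]
  refine (enorm_integral_le_lintegral_enorm _).trans (lintegral_mono fun t => ?_)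
  simp only
  rw [enorm_mul, enorm_ofReal_complex, ← ofReal_norm (D (x - t))]
  gcongr
  exact abs_truncatedHilbertKernel_sub_le hy _

/-- If the conjugate Poisson means of `f` are the Poisson means of `g`, then the principal values
that define the Hilbert transform of `f` converge to `g` almost everywhere. -/
theorem ae_tendsto_truncatedHilbert {p : ℝ} (hp : 1 < p) {f g : ℝ → ℂ}
    (hf : MemLp f (ENNReal.ofReal p)) (hg : MemLp g (ENNReal.ofReal p))
    (hfg : ∀ y, 0 < y → ∀ x,
      kernelConv (conjPoissonLine y) f x = kernelConv (poissonLine y) g x) :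
    ∀ᵐ x, Tendsto (fun ε => truncatedHilbert ε f x) (𝓝[>] 0) (𝓝 (g x)) := by
  filter_upwards [ae_tendsto_lintegral_poissonLine_osc hp hf,
    ae_tendsto_lintegral_poissonLine_osc hp hg] with x hfx hgx
  rw [tendsto_iff_edist_tendsto_0]
  have hsum := hfx.add hgx
  rw [add_zero] at hsum
  refine tendsto_of_tendsto_of_tendsto_of_le_of_le' tendsto_const_nhds hsum
    (Eventually.of_forall fun _ => zero_le) (eventually_mem_nhdsWithin.mono fun y hy => ?_)
  have hy : 0 < y := hy
  rw [edist_eq_enorm_sub]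
  have h : truncatedHilbert y f x - g x =
      (truncatedHilbert y f x - kernelConv (conjPoissonLine y) f x) +
      (kernelConv (poissonLine y) g x - g x) := by rw [hfg y hy x]; ring
  rw [h]
  exact (enorm_add_le _ _).trans (add_le_add (enorm_truncatedHilbert_sub_le hp hf hy x)
    (enorm_kernelConv_poissonLine_sub_le hp hg hy x))

/-- Almost everywhere existence of the Hilbert transform, and its identification. -/
lemma ae_hilbertDefinedAt_and_eq {p : ℝ} (hp : 1 < p) {f g : ℝ → ℂ}
    (hf : MemLp f (ENNReal.ofReal p)) (hg : MemLp g (ENNReal.ofReal p))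
    (hfg : ∀ y, 0 < y → ∀ x,
      kernelConv (conjPoissonLine y) f x = kernelConv (poissonLine y) g x) :
    ∀ᵐ x, HilbertDefinedAt f x ∧ hilbertTransform f x = g x := by
  filter_upwards [ae_tendsto_truncatedHilbert hp hf hg hfg] with x hx
  exact ⟨⟨fun ε hε => integrableOn_truncatedHilbert hp hf hε x, _, hx⟩, hx.limUnder_eq⟩

/-! ### The Hausdorff operator: almost everywhere classes and the upper bound -/

/-- The map s ↦ x/s is its own inverse and differentiable off 0, so it preserves null sets. Hence
H_φ f(x) for x ≠ 0 depends only on the almost everywhere class of f. -/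
lemma volume_Ioi_comp_div_eq_zero {N : Set ℝ} (hN : volume N = 0) {x : ℝ} (hx : x ≠ 0) :
    ∀ᵐ t ∂volume.restrict (Ioi (0 : ℝ)), x / t ∉ N := by
  have h0 : volume ((fun s : ℝ => x / s) '' (N \ {0})) = 0 := by
    refine addHaar_image_eq_zero_of_differentiableOn_of_addHaar_eq_zero volume ?_
      (measure_mono_null sdiff_subset hN)
    intro s hs
    have hs0 : s ≠ 0 := hs.2
    exact ((differentiableAt_const x).fun_div differentiableAt_id hs0).differentiableWithinAt
  rw [ae_restrict_iff' measurableSet_Ioi]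
  filter_upwards [measure_eq_zero_iff_ae_notMem.1 h0] with t ht htp hxt
  have htp : t ≠ 0 := ne_of_gt htp
  exact ht ⟨x / t, ⟨hxt, div_ne_zero hx htp⟩, by field_simp⟩

lemma hausdorff_integrand_ae_eq (φ : ℝ → ℝ) {f g : ℝ → ℂ} (h : f =ᵐ[volume] g) {x : ℝ}
    (hx : x ≠ 0) :
    (fun t : ℝ => f (x / t) * ((φ t / t : ℝ) : ℂ)) =ᵐ[volume.restrict (Ioi 0)]
      fun t : ℝ => g (x / t) * ((φ t / t : ℝ) : ℂ) := by
  filter_upwards [volume_Ioi_comp_div_eq_zero (ae_iff.1 h) hx] with t ht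
  have ht' : f (x / t) = g (x / t) := not_not.1 ht
  rw [ht']

lemma hausdorffOperator_congr (φ : ℝ → ℝ) {f g : ℝ → ℂ} (h : f =ᵐ[volume] g) {x : ℝ}
    (hx : x ≠ 0) : hausdorffOperator φ f x = hausdorffOperator φ g x :=
  integral_congr_ae (hausdorff_integrand_ae_eq φ h hx)

lemma hausdorffDefinedAt_congr (φ : ℝ → ℝ) {f g : ℝ → ℂ} (h : f =ᵐ[volume] g) {x : ℝ}
    (hx : x ≠ 0) : HausdorffDefinedAt φ f x ↔ HausdorffDefinedAt φ g x :=
  integrable_congr (hausdorff_integrand_ae_eq φ h hx)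

lemma ae_ne_zero_real : ∀ᵐ x : ℝ, x ≠ 0 := by
  simp [ae_iff]

lemma hausdorffOperator_ae_congr (φ : ℝ → ℝ) {f g : ℝ → ℂ} (h : f =ᵐ[volume] g) :
    hausdorffOperator φ f =ᵐ[volume] hausdorffOperator φ g :=
  ae_ne_zero_real.mono fun _ hx => hausdorffOperator_congr φ h hx

/-- The integral of the modulus of the integrand of the Hausdorff operator. -/
noncomputable def hausdorffMajorant (φ : ℝ → ℝ) (f : ℝ → ℂ) (x : ℝ) : ℝ≥0∞ :=
  ∫⁻ t in Ioi (0 : ℝ), ‖f (x / t) * ((φ t / t : ℝ) : ℂ)‖ₑ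

lemma measurable_hausdorff_integrand {φ : ℝ → ℝ} (hφ : Measurable φ) {f : ℝ → ℂ}
    (hf : Measurable f) :
    Measurable fun z : ℝ × ℝ => f (z.1 / z.2) * ((φ z.2 / z.2 : ℝ) : ℂ) :=
  (hf.comp (measurable_fst.div measurable_snd)).mul
    (Complex.measurable_ofReal.comp ((hφ.comp measurable_snd).div measurable_snd))

lemma measurable_hausdorffMajorant {φ : ℝ → ℝ} (hφ : Measurable φ) {f : ℝ → ℂ}
    (hf : Measurable f) : Measurable (hausdorffMajorant φ f) :=
  (measurable_hausdorff_integrand hφ hf).enorm.lintegral_prod_right'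

lemma stronglyMeasurable_hausdorffOperator {φ : ℝ → ℝ} (hφ : Measurable φ) {f : ℝ → ℂ}
    (hf : Measurable f) : StronglyMeasurable (hausdorffOperator φ f) :=
  (measurable_hausdorff_integrand hφ hf).stronglyMeasurable.integral_prod_right'

lemma enorm_hausdorffOperator_le (φ : ℝ → ℝ) (f : ℝ → ℂ) (x : ℝ) :
    ‖hausdorffOperator φ f x‖ₑ ≤ hausdorffMajorant φ f x :=
  enorm_integral_le_lintegral_enorm _

lemma hausdorffDefinedAt_of_majorant_lt_top {φ : ℝ → ℝ} (hφ : Measurable φ) {f : ℝ → ℂ}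
    (hf : Measurable f) {x : ℝ} (h : hausdorffMajorant φ f x < ∞) : HausdorffDefinedAt φ f x :=
  ⟨((measurable_hausdorff_integrand hφ hf).comp measurable_prodMk_left).aestronglyMeasurable,
    hasFiniteIntegral_iff_enorm.2 h⟩

lemma lintegral_comp_div_real {t : ℝ} (ht : 0 < t) (h : ℝ → ℝ≥0∞) :
    ∫⁻ x, h (x / t) = ENNReal.ofReal t * ∫⁻ x, h x := by
  have := lintegral_comp_mul_left_real (inv_pos.2 ht) h
  simpa only [inv_inv, inv_mul_eq_div] using this

/-- Minkowski's inequality for the Hausdorff operator, in integrated form. -/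
lemma lintegral_hausdorffMajorant_rpow_le {p : ℝ} (hp : 1 < p) {φ : ℝ → ℝ} (hφ : Measurable φ)
    (hφ0 : ∀ t, 0 ≤ φ t) {f : ℝ → ℂ} (hf : Measurable f) :
    ∫⁻ x, hausdorffMajorant φ f x ^ p ≤ hausdorffIntegral φ p ^ p * ∫⁻ x, ‖f x‖ₑ ^ p := by
  have hp0 : 0 < p := by linarith
  have hpq := Real.HolderConjugate.conjExponent hp
  set w : ℝ → ℝ≥0∞ := fun t => ENNReal.ofReal (t ^ (1 / p - 1) * φ t) with hw
  have hwm : Measurable w := by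
    have : Measurable fun t : ℝ => t ^ (1 / p - 1) := measurable_id.pow_const _
    exact (this.mul hφ).ennreal_ofReal
  -- Against ν, of total mass K, the integrand becomes |f(x/t)| t^(-1/p), whose L^p norm in x is
  -- ‖f‖_p for every t. Jensen then produces K^(p-1) and Tonelli one more factor K.
  set ν := (volume.restrict (Ioi (0 : ℝ))).withDensity w with hν
  have hνu : ν univ = hausdorffIntegral φ p := by
    rw [hν, withDensity_apply _ MeasurableSet.univ, Measure.restrict_univ, hausdorffIntegral]
  have hpt : ∀ x, hausdorffMajorant φ f x = ∫⁻ t, ‖f (x / t)‖ₑ * ENNReal.ofReal (t ^ (-(1 / p))) ∂ν := by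
    intro x
    have hm : Measurable fun t => ‖f (x / t)‖ₑ * ENNReal.ofReal (t ^ (-(1 / p))) := by
      have h2 : Measurable fun t : ℝ => t ^ (-(1 / p)) := measurable_id.pow_const _
      exact (hf.comp (measurable_const.div measurable_id)).enorm.mul h2.ennreal_ofReal
    rw [hν, lintegral_withDensity_eq_lintegral_mul _ hwm hm, hausdorffMajorant]
    refine setLIntegral_congr_fun measurableSet_Ioi fun t ht => ?_
    have ht : 0 < t := ht
    simp only [Pi.mul_apply, hw]
    rw [enorm_mul, enorm_ofReal_complex, Real.enorm_of_nonneg (div_nonneg (hφ0 t) ht.le),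
      mul_left_comm, ← ENNReal.ofReal_mul (mul_nonneg (Real.rpow_nonneg ht.le _) (hφ0 t))]
    congr 2
    rw [mul_right_comm, ← Real.rpow_add ht, show 1 / p - 1 + -(1 / p) = -1 by ring,
      Real.rpow_neg_one, inv_mul_eq_div]
  have hjoint : Measurable fun z : ℝ × ℝ => ‖f (z.1 / z.2)‖ₑ ^ p * ENNReal.ofReal (z.2⁻¹) :=
    ((hf.comp (measurable_fst.div measurable_snd)).enorm.pow_const p).mul
      measurable_snd.inv.ennreal_ofReal
  have hνae : ∀ᵐ t ∂ν, 0 < t :=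
    (withDensity_absolutelyContinuous _ _).ae_le (ae_restrict_mem measurableSet_Ioi)
  calc ∫⁻ x, hausdorffMajorant φ f x ^ p
      ≤ ∫⁻ x, ν univ ^ (p - 1) * ∫⁻ t, ‖f (x / t)‖ₑ ^ p * ENNReal.ofReal (t⁻¹) ∂ν := by
        refine lintegral_mono fun x => ?_
        rw [hpt]
        have hm : Measurable fun t => ‖f (x / t)‖ₑ * ENNReal.ofReal (t ^ (-(1 / p))) := by
          have h2 : Measurable fun t : ℝ => t ^ (-(1 / p)) := measurable_id.pow_const _
          exact (hf.comp (measurable_const.div measurable_id)).enorm.mul h2.ennreal_ofReal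
        refine (lintegral_rpow_le_measure_univ ν hpq hm.aemeasurable).trans_eq ?_
        congr 1
        refine lintegral_congr_ae (hνae.mono fun t ht => ?_)
        simp only
        rw [ENNReal.mul_rpow_of_nonneg _ _ hp0.le,
          ENNReal.ofReal_rpow_of_nonneg (Real.rpow_nonneg ht.le _) hp0.le, ← Real.rpow_mul ht.le,
          show -(1 / p) * p = -1 by field_simp, Real.rpow_neg_one]
    _ = ν univ ^ (p - 1) * ∫⁻ x, ∫⁻ t, ‖f (x / t)‖ₑ ^ p * ENNReal.ofReal (t⁻¹) ∂ν :=
        lintegral_const_mul _ hjoint.lintegral_prod_right'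
    _ = ν univ ^ (p - 1) * ∫⁻ t, (∫⁻ x, ‖f (x / t)‖ₑ ^ p * ENNReal.ofReal (t⁻¹)) ∂ν := by
        rw [lintegral_lintegral_swap hjoint.aemeasurable]
    _ = ν univ ^ (p - 1) * ∫⁻ _, (∫⁻ x, ‖f x‖ₑ ^ p) ∂ν := by
        congr 1
        refine lintegral_congr_ae (hνae.mono fun t ht => ?_)
        simp only
        rw [lintegral_mul_const' _ _ ENNReal.ofReal_ne_top,
          lintegral_comp_div_real ht fun x => ‖f x‖ₑ ^ p, mul_right_comm,
          ← ENNReal.ofReal_mul ht.le, mul_inv_cancel₀ ht.ne', ENNReal.ofReal_one, one_mul]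
    _ = hausdorffIntegral φ p ^ p * ∫⁻ x, ‖f x‖ₑ ^ p := by
        rw [lintegral_const, hνu, mul_comm (∫⁻ x, ‖f x‖ₑ ^ p), ← mul_assoc]
        congr 1
        conv_lhs => rw [← ENNReal.rpow_one (hausdorffIntegral φ p), ← ENNReal.rpow_mul]
        rw [one_mul, ← ENNReal.rpow_add_of_nonneg _ _ (by linarith) zero_le_one]
        congr 1; ring

/-- The Hausdorff operator is bounded by the integral of `t ^ (1 / p - 1) φ(t)`. -/
lemma hausdorffOperator_bound {p : ℝ} (hp : 1 < p) {φ : ℝ → ℝ} (hφ : Measurable φ)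
    (hφ0 : ∀ t, 0 ≤ φ t) (hK : hausdorffIntegral φ p < ∞) {f : ℝ → ℂ}
    (hf : MemLp f (ENNReal.ofReal p)) :
    (∀ᵐ x, HausdorffDefinedAt φ f x) ∧ MemLp (hausdorffOperator φ f) (ENNReal.ofReal p) ∧
    eLpNorm (hausdorffOperator φ f) (ENNReal.ofReal p) ≤
      hausdorffIntegral φ p * eLpNorm f (ENNReal.ofReal p) := by
  have hp0 : 0 < p := by linarith
  wlog hfm : Measurable f generalizing f
  · obtain ⟨f', hf', hae⟩ : ∃ f', StronglyMeasurable f' ∧ f =ᵐ[volume] f' := hf.1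
    obtain ⟨h1, h2, h3⟩ := this ((memLp_congr_ae hae).1 hf) hf'.measurable
    have hH := hausdorffOperator_ae_congr φ hae
    refine ⟨?_, (memLp_congr_ae hH).2 h2, ?_⟩
    · filter_upwards [h1, ae_ne_zero_real] with x hx hx0
      exact (hausdorffDefinedAt_congr φ hae hx0).2 hx
    · rwa [eLpNorm_congr_ae hH, eLpNorm_congr_ae hae]
  have hle := lintegral_hausdorffMajorant_rpow_le hp hφ hφ0 hfm
  rw [← eLpNorm_ofReal_rpow hp0, ← ENNReal.mul_rpow_of_nonneg _ _ hp0.le] at hle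
  have hfin : (hausdorffIntegral φ p * eLpNorm f (ENNReal.ofReal p)) ^ p < ∞ :=
    ENNReal.rpow_lt_top_of_nonneg hp0.le (ENNReal.mul_ne_top hK.ne hf.eLpNorm_ne_top)
  have hbd : eLpNorm (hausdorffOperator φ f) (ENNReal.ofReal p) ≤
      hausdorffIntegral φ p * eLpNorm f (ENNReal.ofReal p) := by
    rw [← ENNReal.rpow_le_rpow_iff hp0, eLpNorm_ofReal_rpow hp0]
    exact (lintegral_mono fun x => ENNReal.rpow_le_rpow (enorm_hausdorffOperator_le φ f x)
      hp0.le).trans hle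
  refine ⟨?_, ⟨(stronglyMeasurable_hausdorffOperator hφ hfm).aestronglyMeasurable,
    hbd.trans_lt (ENNReal.mul_lt_top hK hf.2)⟩, hbd⟩
  filter_upwards [ae_lt_top ((measurable_hausdorffMajorant hφ hfm).pow_const p)
    (hle.trans_lt hfin).ne] with x hx
  exact hausdorffDefinedAt_of_majorant_lt_top hφ hfm ((ENNReal.rpow_lt_top_iff_of_pos hp0).1 hx)

/-! ### The lower bound for the norm -/

lemma lintegral_Icc_one_div {a b : ℝ} (ha : 0 < a) (hab : a ≤ b) :
    ∫⁻ x in Icc a b, ENNReal.ofReal (1 / x) = ENNReal.ofReal (Real.log (b / a)) := by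
  have hint : IntegrableOn (fun x : ℝ => 1 / x) (Icc a b) := by
    refine ContinuousOn.integrableOn_Icc (ContinuousOn.div continuousOn_const continuousOn_id ?_)
    exact fun x hx => (ha.trans_le hx.1).ne'
  rw [← ofReal_integral_eq_lintegral_ofReal hint, integral_Icc_eq_integral_Ioc,
    ← intervalIntegral.integral_of_le hab, integral_one_div_of_pos ha (ha.trans_le hab)]
  filter_upwards [ae_restrict_mem measurableSet_Icc] with x hx
  exact one_div_nonneg.2 (ha.trans_le hx.1).le

/-- Truncated powers, the extremisers of dilation-invariant operators. -/
noncomputable def truncatedPower (p L x : ℝ) : ℝ :=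
  (Icc 1 (Real.exp L)).indicator (fun x => x ^ (-(1 / p))) x

lemma truncatedPower_nonneg (p L x : ℝ) : 0 ≤ truncatedPower p L x :=
  indicator_nonneg (fun _ hx => Real.rpow_nonneg (zero_le_one.trans hx.1) _) x

lemma measurable_truncatedPower (p L : ℝ) : Measurable (truncatedPower p L) :=
  (measurable_id.pow_const (-(1 / p))).indicator measurableSet_Icc

lemma ofReal_rpow_neg_one_div_rpow {p : ℝ} (hp : 0 < p) {x : ℝ} (hx : 0 < x) :
    ENNReal.ofReal (x ^ (-(1 / p))) ^ p = ENNReal.ofReal (1 / x) := by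
  rw [ENNReal.ofReal_rpow_of_nonneg (Real.rpow_nonneg hx.le _) hp.le, ← Real.rpow_mul hx.le,
    show -(1 / p) * p = -1 by field_simp, Real.rpow_neg_one, one_div]

lemma lintegral_truncatedPower {p : ℝ} (hp : 0 < p) {L : ℝ} (hL : 0 ≤ L) :
    ∫⁻ x, ‖(truncatedPower p L x : ℂ)‖ₑ ^ p = ENNReal.ofReal L := by
  have h : ∀ x, ‖(truncatedPower p L x : ℂ)‖ₑ ^ p =
      (Icc 1 (Real.exp L)).indicator (fun x => ENNReal.ofReal (1 / x)) x := fun x => by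
    rw [enorm_ofReal_complex, Real.enorm_of_nonneg (truncatedPower_nonneg p L x)]
    by_cases hx : x ∈ Icc 1 (Real.exp L)
    · rw [truncatedPower, indicator_of_mem hx, indicator_of_mem hx,
        ofReal_rpow_neg_one_div_rpow hp (one_pos.trans_le hx.1)]
    · rw [truncatedPower, indicator_of_notMem hx, indicator_of_notMem hx, ENNReal.ofReal_zero,
        ENNReal.zero_rpow_of_pos hp]
  simp only [h]
  rw [lintegral_indicator measurableSet_Icc, lintegral_Icc_one_div one_pos (Real.one_le_exp hL),
    div_one, Real.log_exp]

lemma memLp_truncatedPower {p : ℝ} (hp : 0 < p) {L : ℝ} (hL : 0 ≤ L) :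
    MemLp (fun x => (truncatedPower p L x : ℂ)) (ENNReal.ofReal p) := by
  refine ⟨(Complex.measurable_ofReal.comp (measurable_truncatedPower p L)).aestronglyMeasurable, ?_⟩
  rw [← ENNReal.rpow_lt_top_iff_of_pos hp, eLpNorm_ofReal_rpow hp, lintegral_truncatedPower hp hL]
  exact ENNReal.ofReal_lt_top

/-- Where it converges, the Hausdorff operator with a nonnegative kernel of a nonnegative function
has modulus the integral of the modulus. -/
lemma enorm_hausdorffOperator_of_nonneg {φ : ℝ → ℝ} (hφ0 : ∀ t, 0 ≤ φ t) {f : ℝ → ℝ}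
    (hf0 : ∀ x, 0 ≤ f x) {x : ℝ} (h : HausdorffDefinedAt φ (fun x => (f x : ℂ)) x) :
    ‖hausdorffOperator φ (fun x => (f x : ℂ)) x‖ₑ = hausdorffMajorant φ (fun x => (f x : ℂ)) x := by
  have h1 : hausdorffOperator φ (fun x => (f x : ℂ)) x =
      ((∫ t in Ioi (0 : ℝ), ‖(f (x / t) : ℂ) * ((φ t / t : ℝ) : ℂ)‖ : ℝ) : ℂ) := by
    have h2 : hausdorffOperator φ (fun x => (f x : ℂ)) x =
        ∫ t in Ioi (0 : ℝ), ((‖(f (x / t) : ℂ) * ((φ t / t : ℝ) : ℂ)‖ : ℝ) : ℂ) := by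
      refine setIntegral_congr_fun measurableSet_Ioi fun t ht => ?_
      have ht : 0 < t := ht
      simp only
      rw [norm_mul, Complex.norm_real, Complex.norm_real, Real.norm_of_nonneg (hf0 _),
        Real.norm_of_nonneg (div_nonneg (hφ0 t) ht.le), Complex.ofReal_mul]
    rw [h2]
    exact integral_ofReal
  rw [h1, enorm_ofReal_complex, Real.enorm_of_nonneg (integral_nonneg fun t => norm_nonneg _),
    ofReal_integral_norm_eq_lintegral_enorm h, hausdorffMajorant]

/-- For such x and for t in [e^(-l), e^l], the quotient x/t stays in [1, e^L]. There the truncated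
power is the homogeneous function x^(-1/p), and the factor in x splits off. -/
lemma le_hausdorffMajorant_truncatedPower {p : ℝ} {φ : ℝ → ℝ} (hφ0 : ∀ t, 0 ≤ φ t) {l L x : ℝ}
    (hx : x ∈ Icc (Real.exp l) (Real.exp (L - l))) :
    ENNReal.ofReal (x ^ (-(1 / p))) * ∫⁻ t in Icc (Real.exp (-l)) (Real.exp l),
      ENNReal.ofReal (t ^ (1 / p - 1) * φ t) ≤
    hausdorffMajorant φ (fun x => (truncatedPower p L x : ℂ)) x := by
  have hxp : 0 < x := (Real.exp_pos l).trans_le hx.1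
  rw [← lintegral_const_mul' _ _ ENNReal.ofReal_ne_top, hausdorffMajorant]
  refine (setLIntegral_mono' measurableSet_Icc fun t ht => ?_).trans
    (lintegral_mono_set fun t ht => (Real.exp_pos (-l)).trans_le ht.1)
  have htp : 0 < t := (Real.exp_pos (-l)).trans_le ht.1
  have hmem : x / t ∈ Icc 1 (Real.exp L) := by
    constructor
    · rw [le_div_iff₀ htp, one_mul]; exact ht.2.trans hx.1
    · rw [div_le_iff₀ htp]
      refine hx.2.trans ?_
      rw [sub_eq_add_neg, Real.exp_add]
      gcongr
      exact ht.1
  rw [truncatedPower, indicator_of_mem hmem, ← Complex.ofReal_mul, enorm_ofReal_complex,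
    Real.enorm_of_nonneg (mul_nonneg (Real.rpow_nonneg (by positivity) _)
      (div_nonneg (hφ0 t) htp.le)), ← ENNReal.ofReal_mul (by positivity)]
  refine ENNReal.ofReal_le_ofReal (le_of_eq ?_)
  rw [Real.div_rpow hxp.le htp.le, Real.rpow_neg htp.le (1 / p), Real.rpow_sub htp, Real.rpow_one]
  have := (Real.rpow_pos_of_pos htp (1 / p)).ne'
  field_simp

/-- The integral of `t ^ (1 / p - 1) φ(t)` is a lower bound for the norm of the Hausdorff
operator. -/
lemma hausdorffIntegral_le_of_bound {p : ℝ} (hp : 1 < p) {φ : ℝ → ℝ} (hφ : Measurable φ)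
    (hφ0 : ∀ t, 0 ≤ φ t) {C : ℝ≥0∞}
    (hdef : ∀ f : ℝ → ℂ, MemLp f (ENNReal.ofReal p) → ∀ᵐ x, HausdorffDefinedAt φ f x)
    (hC : ∀ f : ℝ → ℂ, MemLp f (ENNReal.ofReal p) →
      eLpNorm (hausdorffOperator φ f) (ENNReal.ofReal p) ≤ C * eLpNorm f (ENNReal.ofReal p)) :
    hausdorffIntegral φ p ≤ C := by
  have hp0 : 0 < p := by linarith
  have hwm : Measurable fun t => ENNReal.ofReal (t ^ (1 / p - 1) * φ t) := by
    have : Measurable fun t : ℝ => t ^ (1 / p - 1) := measurable_id.pow_const _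
    exact (this.mul hφ).ennreal_ofReal
  set A : ℝ → ℝ≥0∞ := fun l => ∫⁻ t in Icc (Real.exp (-l)) (Real.exp l),
    ENNReal.ofReal (t ^ (1 / p - 1) * φ t) with hA
  -- The p-th power of the test function is 1/x on [1, e^L], of mass L; the interval [e^l, e^(L-l)]
  -- free of edge effects carries mass L - 2l.
  have hkey : ∀ l L : ℝ, 0 ≤ l → 2 * l < L →
      ENNReal.ofReal (1 - 2 * l / L) * A l ^ p ≤ C ^ p := by
    intro l L hl hL
    have hL0 : 0 < L := by linarith
    have h1 := hC _ (memLp_truncatedPower hp0 hL0.le)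
    rw [← ENNReal.rpow_le_rpow_iff hp0, ENNReal.mul_rpow_of_nonneg _ _ hp0.le,
      eLpNorm_ofReal_rpow hp0, eLpNorm_ofReal_rpow hp0, lintegral_truncatedPower hp0 hL0.le] at h1
    have h2 : ENNReal.ofReal (L - 2 * l) * A l ^ p ≤
        ∫⁻ x, ‖hausdorffOperator φ (fun x => (truncatedPower p L x : ℂ)) x‖ₑ ^ p := by
      have hlog : ENNReal.ofReal (L - 2 * l) =
          ∫⁻ x in Icc (Real.exp l) (Real.exp (L - l)), ENNReal.ofReal (1 / x) := by
        rw [lintegral_Icc_one_div (Real.exp_pos l) (Real.exp_le_exp.2 (by linarith)),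
          ← Real.exp_sub, Real.log_exp]
        congr 1; ring
      have hm : Measurable fun x : ℝ => ENNReal.ofReal (1 / x) := by fun_prop
      rw [hlog, ← lintegral_mul_const _ hm]
      refine le_trans ?_ (setLIntegral_le_lintegral (Icc (Real.exp l) (Real.exp (L - l))) _)
      refine lintegral_mono_ae ?_
      filter_upwards [ae_restrict_mem measurableSet_Icc,
        ae_restrict_of_ae (hdef _ (memLp_truncatedPower hp0 hL0.le))] with x hx hxd
      rw [← ofReal_rpow_neg_one_div_rpow hp0 ((Real.exp_pos l).trans_le hx.1),
        ← ENNReal.mul_rpow_of_nonneg _ _ hp0.le,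
        enorm_hausdorffOperator_of_nonneg hφ0 (truncatedPower_nonneg p L) hxd]
      exact ENNReal.rpow_le_rpow (le_hausdorffMajorant_truncatedPower hφ0 hx) hp0.le
    have h3 := h2.trans h1
    have h4 : ENNReal.ofReal (L - 2 * l) = ENNReal.ofReal (1 - 2 * l / L) * ENNReal.ofReal L := by
      rw [← ENNReal.ofReal_mul' hL0.le]
      congr 1; field_simp
    rw [h4, mul_right_comm] at h3
    exact (ENNReal.mul_le_mul_iff_left (ENNReal.ofReal_pos.2 hL0).ne' ENNReal.ofReal_ne_top).1 h3
  -- First L → ∞ with l fixed, which removes the edge loss; afterwards l → ∞ exhausts (0, ∞).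
  have hAle : ∀ l, 0 ≤ l → A l ≤ C := by
    intro l hl
    rw [← ENNReal.rpow_le_rpow_iff hp0]
    have hlim : Tendsto (fun L : ℝ => ENNReal.ofReal (1 - 2 * l / L) * A l ^ p) atTop
        (𝓝 (ENNReal.ofReal 1 * A l ^ p)) := by
      refine ENNReal.Tendsto.mul_const (ENNReal.tendsto_ofReal ?_) (Or.inl (by simp))
      simpa using (tendsto_const_nhds (x := 2 * l)).div_atTop tendsto_id |>.const_sub 1
    rw [ENNReal.ofReal_one, one_mul] at hlim
    exact le_of_tendsto hlim ((eventually_gt_atTop (2 * l)).mono fun L hL => hkey l L hl hL)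
  have hcover : AECover (volume.restrict (Ioi (0 : ℝ))) atTop
      (fun n : ℕ => Icc (Real.exp (-(n : ℝ))) (Real.exp n)) :=
    (aecover_Ioi_of_Ici
      (Real.tendsto_exp_atBot.comp (tendsto_neg_atTop_atBot.comp tendsto_natCast_atTop_atTop))).inter
      (aecover_Iic (Real.tendsto_exp_atTop.comp tendsto_natCast_atTop_atTop))
  have hlim := hcover.lintegral_tendsto_of_countably_generated hwm.aemeasurable
  refine le_of_tendsto hlim (Eventually.of_forall fun n => ?_)
  rw [Measure.restrict_restrict measurableSet_Icc]
  exact (lintegral_mono_set inter_subset_left).trans (hAle n n.cast_nonneg)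

/-! ### Dilations and commutation with the Hilbert transform -/

lemma poissonLine_scale {t : ℝ} (ht : 0 < t) (y u : ℝ) :
    poissonLine y (t * u) = t⁻¹ * poissonLine (y / t) u := by
  unfold poissonLine
  have h : (t * u) ^ 2 + y ^ 2 = t ^ 2 * (u ^ 2 + (y / t) ^ 2) := by field_simp
  rw [h, ← div_div, show y / t ^ 2 = t⁻¹ * (y / t) by field_simp, mul_div_assoc]
  ring

lemma conjPoissonLine_scale {t : ℝ} (ht : 0 < t) (y u : ℝ) :
    conjPoissonLine y (t * u) = t⁻¹ * conjPoissonLine (y / t) u := by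
  unfold conjPoissonLine
  have h : (t * u) ^ 2 + y ^ 2 = t ^ 2 * (u ^ 2 + (y / t) ^ 2) := by field_simp
  rw [h, ← div_div, show t * u / t ^ 2 = t⁻¹ * u by field_simp, mul_div_assoc]
  ring

/-- Substitution u = tv. For both Poisson families k' is the kernel of the same family at height
y/t, so a relation valid at all heights survives dilation. -/
lemma kernelConv_comp_div {k k' : ℝ → ℝ} {t : ℝ} (ht : 0 < t)
    (hk : ∀ u, k (t * u) = t⁻¹ * k' u) (f : ℝ → ℂ) (x : ℝ) :
    kernelConv k (fun u => f (u / t)) x = kernelConv k' f (x / t) := by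
  have h1 := Measure.integral_comp_mul_left
    (fun u => ((k (x - u) : ℝ) : ℂ) * f (u / t)) t
  have h2 : ∀ v, ((k (x - t * v) : ℝ) : ℂ) * f (t * v / t) =
      (t : ℂ)⁻¹ * (((k' (x / t - v) : ℝ) : ℂ) * f v) := fun v => by
    rw [show x - t * v = t * (x / t - v) by field_simp, hk, mul_div_cancel_left₀ v ht.ne']
    push_cast; ring
  simp only [h2] at h1
  rw [integral_const_mul, abs_of_pos (inv_pos.2 ht), Complex.real_smul, Complex.ofReal_inv] at h1
  exact (mul_left_cancel₀ (inv_ne_zero (Complex.ofReal_ne_zero.2 ht.ne')) h1).symm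

/-- Convolution with the Hausdorff operator of `f`, as a superposition over dilations. -/
lemma kernelConv_hausdorffOperator {p q : ℝ} (hpq : p.HolderConjugate q) {φ : ℝ → ℝ}
    (hφ : Measurable φ) (hφ0 : ∀ t, 0 ≤ φ t) (hK : hausdorffIntegral φ p < ∞)
    {f : ℝ → ℂ} (hf : MemLp f (ENNReal.ofReal p)) (hfm : Measurable f) {k : ℝ → ℝ}
    (hkm : Measurable k) (hk : MemLp k (ENNReal.ofReal q)) (x : ℝ) :
    kernelConv k (hausdorffOperator φ f) x =
      ∫ t in Ioi (0 : ℝ), kernelConv k (fun u => f (u / t)) x * ((φ t / t : ℝ) : ℂ) := by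
  have hp0 := hpq.pos
  have hm : Measurable (Function.uncurry fun u t : ℝ =>
      ((k (x - u) : ℝ) : ℂ) * (f (u / t) * ((φ t / t : ℝ) : ℂ))) :=
    (Complex.measurable_ofReal.comp (hkm.comp (measurable_const.sub measurable_fst))).mul
      (measurable_hausdorff_integrand hφ hfm)
  have hint : Integrable (Function.uncurry fun u t : ℝ =>
      ((k (x - u) : ℝ) : ℂ) * (f (u / t) * ((φ t / t : ℝ) : ℂ)))
      (volume.prod (volume.restrict (Ioi 0))) := by
    refine ⟨hm.aestronglyMeasurable, ?_⟩
    rw [hasFiniteIntegral_iff_enorm, lintegral_prod _ hm.enorm.aemeasurable]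
    have h1 : ∀ u, ∫⁻ t in Ioi (0 : ℝ),
        ‖((k (x - u) : ℝ) : ℂ) * (f (u / t) * ((φ t / t : ℝ) : ℂ))‖ₑ =
        ‖k (x - u)‖ₑ * hausdorffMajorant φ f u := fun u => by
      simp only [enorm_mul ((k (x - u) : ℝ) : ℂ), enorm_ofReal_complex (k (x - u))]
      rw [lintegral_const_mul]
      · rfl
      · exact ((measurable_hausdorff_integrand hφ hfm).comp measurable_prodMk_left).enorm
    simp only [Function.uncurry, h1]
    have hkx : AEMeasurable fun t => ‖k (x - t)‖ₑ :=
      (hkm.comp (measurable_id.const_sub x)).enorm.aemeasurable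
    -- Absolute convergence of the double integral: Hölder pairs the kernel in L^q with the majorant
    -- of H_φ f, which is in L^p.
    refine (ENNReal.lintegral_mul_le_Lp_mul_Lq volume hpq.symm hkx
      (measurable_hausdorffMajorant hφ hfm).aemeasurable).trans_lt ?_
    refine ENNReal.mul_lt_top (ENNReal.rpow_lt_top_of_nonneg (by simpa using hpq.symm.nonneg) ?_)
      (ENNReal.rpow_lt_top_of_nonneg (by simpa using hpq.nonneg) ?_)
    · rw [lintegral_sub_left_eq_self (fun t => ‖k t‖ₑ ^ q) x, ← eLpNorm_ofReal_rpow hpq.symm.pos]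
      exact ENNReal.rpow_ne_top_of_nonneg hpq.symm.nonneg hk.eLpNorm_ne_top
    · refine ne_top_of_le_ne_top ?_ (lintegral_hausdorffMajorant_rpow_le hpq.lt hφ hφ0 hfm)
      rw [← eLpNorm_ofReal_rpow hp0]
      exact ENNReal.mul_ne_top (ENNReal.rpow_ne_top_of_nonneg hp0.le hK.ne)
        (ENNReal.rpow_ne_top_of_nonneg hp0.le hf.eLpNorm_ne_top)
  simp only [kernelConv, hausdorffOperator, ← integral_const_mul, ← integral_mul_const]
  rw [integral_integral_swap hint]
  simp only [mul_assoc]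

/-- If the conjugate Poisson means of `f` are the Poisson means of `g`, then the same holds for
`H_φ f` and `H_φ g`. -/
lemma kernelConv_hausdorffOperator_conj {p : ℝ} (hp : 1 < p) {φ : ℝ → ℝ}
    (hφ : Measurable φ) (hφ0 : ∀ t, 0 ≤ φ t) (hK : hausdorffIntegral φ p < ∞) {f g : ℝ → ℂ}
    (hf : MemLp f (ENNReal.ofReal p)) (hg : MemLp g (ENNReal.ofReal p))
    (hfg : ∀ y, 0 < y → ∀ x,
      kernelConv (conjPoissonLine y) f x = kernelConv (poissonLine y) g x) :
    ∀ y, 0 < y → ∀ x, kernelConv (conjPoissonLine y) (hausdorffOperator φ f) x =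
      kernelConv (poissonLine y) (hausdorffOperator φ g) x := by
  intro y hy x
  have hpq := Real.HolderConjugate.conjExponent hp
  obtain ⟨f', hf', hff'⟩ : ∃ f', StronglyMeasurable f' ∧ f =ᵐ[volume] f' := hf.1
  obtain ⟨g', hg', hgg'⟩ : ∃ g', StronglyMeasurable g' ∧ g =ᵐ[volume] g' := hg.1
  rw [kernelConv_congr _ (hausdorffOperator_ae_congr φ hff'),
    kernelConv_congr _ (hausdorffOperator_ae_congr φ hgg'),
    kernelConv_hausdorffOperator hpq hφ hφ0 hK ((memLp_congr_ae hff').1 hf) hf'.measurable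
      (measurable_conjPoissonLine y) (memLp_conjPoissonLine hy hpq.symm.lt),
    kernelConv_hausdorffOperator hpq hφ hφ0 hK ((memLp_congr_ae hgg').1 hg) hg'.measurable
      (measurable_poissonLine y) (memLp_poissonLine hy hpq.symm.lt)]
  -- The integrands agree for each t: this is the hypothesis on (f, g) at height y/t and point x/t.
  refine setIntegral_congr_fun measurableSet_Ioi fun t ht => ?_
  have ht : 0 < t := ht
  rw [kernelConv_comp_div ht (conjPoissonLine_scale ht y), kernelConv_comp_div ht
    (poissonLine_scale ht y), ← kernelConv_congr _ hff', ← kernelConv_congr _ hgg',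
    hfg _ (div_pos hy ht)]

/-- The Hausdorff operator commutes with the Hilbert transform. -/
theorem hausdorffCommutesWithHilbert_of_lt_top {p : ℝ} (hp : 1 < p) {φ : ℝ → ℝ}
    (hφ : Measurable φ) (hφ0 : ∀ t, 0 ≤ φ t) (hK : hausdorffIntegral φ p < ∞) :
    HausdorffCommutesWithHilbert φ (ENNReal.ofReal p) := by
  intro f hf
  obtain ⟨g, hg, hfg⟩ := exists_memLp_conjugate hp hf
  have h1 := ae_hilbertDefinedAt_and_eq hp hf hg hfg
  obtain ⟨-, hHf, -⟩ := hausdorffOperator_bound hp hφ hφ0 hK hf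
  obtain ⟨hdg, hHg, -⟩ := hausdorffOperator_bound hp hφ hφ0 hK hg
  have h2 := ae_hilbertDefinedAt_and_eq hp hHf hHg
    (kernelConv_hausdorffOperator_conj hp hφ hφ0 hK hf hg hfg)
  have hae : hilbertTransform f =ᵐ[volume] g := h1.mono fun x hx => hx.2
  refine ⟨h1.mono fun x hx => hx.1, (memLp_congr_ae hae).2 hg, h2.mono fun x hx => hx.1, ?_, ?_⟩
  · filter_upwards [hdg, ae_ne_zero_real] with x hx hx0
    exact (hausdorffDefinedAt_congr φ hae hx0).2 hx
  · filter_upwards [h2, ae_ne_zero_real] with x hx hx0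
    rw [hausdorffOperator_congr φ hae hx0, hx.2]

/-! ### Conclusion -/

lemma hausdorffBoundedOn_iff_and_norm_eq {p : ℝ} (hp : 1 < p) {φ : ℝ → ℝ}
    (hφ : Measurable φ) (hφ0 : ∀ t, 0 ≤ φ t) :
    (HausdorffBoundedOn φ (ENNReal.ofReal p) ↔ hausdorffIntegral φ p < ∞) ∧
    (hausdorffIntegral φ p < ∞ → hausdorffNorm φ (ENNReal.ofReal p) = hausdorffIntegral φ p) := by
  refine ⟨⟨?_, fun hK => ?_⟩, fun hK => le_antisymm ?_ ?_⟩
  · rintro ⟨C, hC⟩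
    exact (hausdorffIntegral_le_of_bound hp hφ hφ0 (fun f hf => (hC f hf).1)
      fun f hf => (hC f hf).2.2).trans_lt ENNReal.coe_lt_top
  · refine ⟨(hausdorffIntegral φ p).toNNReal, fun f hf => ?_⟩
    rw [ENNReal.coe_toNNReal hK.ne]
    exact hausdorffOperator_bound hp hφ hφ0 hK hf
  · exact sInf_le fun f hf => (hausdorffOperator_bound hp hφ hφ0 hK hf).2.2
  -- The infimum imposes no convergence requirement on its constants; almost everywhere convergence
  -- comes from K < ∞.
  · exact le_sInf fun C hC => hausdorffIntegral_le_of_bound hp hφ hφ0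
      (fun f hf => (hausdorffOperator_bound hp hφ hφ0 hK hf).1) hC

theorem theorem3p1 (p : ℝ) (hp : 1 < p) (φ : ℝ → ℝ)
    (hφ : LocallyIntegrableOn φ (Ioi 0) volume) (hφ0 : ∀ t : ℝ, 0 < t → 0 ≤ φ t) :
    (HausdorffBoundedOn φ (ENNReal.ofReal p) ↔ hausdorffIntegral φ p < ∞) ∧
    (hausdorffIntegral φ p < ∞ →
      hausdorffNorm φ (ENNReal.ofReal p) = hausdorffIntegral φ p ∧
      HausdorffCommutesWithHilbert φ (ENNReal.ofReal p)) := by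
  -- Only the class of φ on (0, ∞) matters, so φ may be replaced by a Borel function that is
  -- nonnegative everywhere. The operators then coincide at every point.
  obtain ⟨ψ, hψm, hψ0, hφψ⟩ : ∃ ψ : ℝ → ℝ, Measurable ψ ∧ (∀ t, 0 ≤ ψ t) ∧
      φ =ᵐ[volume.restrict (Ioi 0)] ψ := by
    obtain ⟨ψ, hψ, hae⟩ : ∃ ψ, StronglyMeasurable ψ ∧ φ =ᵐ[volume.restrict (Ioi 0)] ψ :=
      hφ.aestronglyMeasurable
    refine ⟨fun t => max (ψ t) 0, hψ.measurable.max measurable_const, fun t => le_max_right _ _, ?_⟩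
    filter_upwards [hae, ae_restrict_mem measurableSet_Ioi] with t ht htp
    rw [← ht, max_eq_left (hφ0 t htp)]
  have hop : hausdorffOperator φ = hausdorffOperator ψ := by
    funext f x
    exact integral_congr_ae (hφψ.mono fun t ht => by simp only [ht])
  have hdef : HausdorffDefinedAt φ = HausdorffDefinedAt ψ := by
    funext f x
    exact propext (integrable_congr (hφψ.mono fun t ht => by simp only [ht]))
  have hint : hausdorffIntegral φ p = hausdorffIntegral ψ p :=
    lintegral_congr_ae (hφψ.mono fun t ht => by simp only [ht])
  obtain ⟨h1, h2⟩ := hausdorffBoundedOn_iff_and_norm_eq hp hψm hψ0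
  unfold HausdorffBoundedOn hausdorffNorm HausdorffCommutesWithHilbert
  rw [hop, hdef, hint]
  exact ⟨h1, fun hK => ⟨h2 hK, hausdorffCommutesWithHilbert_of_lt_top hp hψm hψ0 hK⟩⟩
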